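/- Let $H$ be a separable (real or complex) Hilbert space, $(\Omega,\mathcal A,\mathbb P)$ a probability space and $n\ge 2$ an integer. Let $\{\epsilon_t\}_{t\in\mathbb Z}$ be an i.i.d. sequence of random elements of a measurable space $S$ on $\Omega$, let $\{\epsilon'_t\}_{t\in\mathbb Z}$ be an independent copy of it on $\Omega$, and let $X_t=g(\epsilon_t,\epsilon_{t-1},\dots)$, $t\in\mathbb Z$, for a measurable $g\colon S^\infty\to H$, so that $\{X_t\}$ is stationary. Assume $\mathbb E\|X_t\|_H^n<\infty$ and $\mathbb E X_t=0$. For $I\subset\mathbb Z$ put $\epsilon_{t,I}=\epsilon'_t$ if $t\in I$ and $\epsilon_{t,I}=\epsilon_t$ if $t\notin I$, let $\mathcal G_{t,I}=\sigma(\epsilon_{t,I},\epsilon_{t-1,I},\dots)$, and for integers $j_1,\dots,j_k\ge 0$ define $$\nu_{X,\mathbb H,p}(j_1,\dots,j_k)=\Big\|X_0+\sum_{i=1}^{k}(-1)^i\sum_{1\le l_1<\dots<l_i\le k}\mathbb E\big[X_0\,\big|\,\mathcal G_{0,\{-j_{l_1},\dots,-j_{l_i}\}}\big]\Big\|_{\mathbb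 H,p},\qquad \|Y\|_{\mathbb H,p}=(\mathbb E\|Y\|_H^p)^{1/p}.$$ For $H$-valued $Y_1,\dots,Y_m$ with $\mathbb E\|Y_i\|_H^m<\infty$ the joint cumulant tensor is $$\mathrm{cum}(Y_1,\dots,Y_m)=\sum_{v=\{v_1,\dots,v_\rho\}}(-1)^{\rho-1}(\rho-1)!\;\Pi_v\Big(\bigotimes_{r=1}^{\rho}\mathbb E\Big[\bigotimes_{i\in v_r}Y_i\Big]\Big)\in H^{\otimes m},$$ where the sum is over all unordered partitions $v$ of $\{1,\dots,m\}$, $H^{\otimes m}$ is the Hilbert tensor product and $\Pi_v$ permutes the tensor components back into the original order. Let $|||\cdot|||_2$ denote the Hilbert–Schmidt norm, i.e. the norm of $H^{\otimes m}$. If, with $p=n$, $$\sum_{j_1,\dots,j_{n-1}=0}^{\infty}\nu_{X,\mathbb H,n}(j_1,\dots,j_{n-1})<\infty,$$ then for every $1\le i\le n$ $$\sum_{t_1,\dots,t_{i-1}\in\mathbb Z}|||\mathrm{cum}(X_{t_1},\dots,X_{t_{i-1}},X_0)|||_2<\infty .$$ -/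

import Mathlib

open MeasureTheory ProbabilityTheory
open scoped ENNReal Nat

noncomputable section

namespace FunctionalCumulant

section Dependence

variable {Ω S H : Type*} [mΩ : MeasurableSpace Ω] [MeasurableSpace S]

/-- `ε` is an i.i.d. sequence (indexed by `ℤ`) of random elements of the measurable space `S`. -/
structure IsIID (P : Measure Ω) (ε : ℤ → Ω → S) : Prop where
  measurable : ∀ t, Measurable (ε t)
  indep : iIndepFun ε P
  identDistrib : ∀ t, IdentDistrib (ε t) (ε 0) P P

/-- `ε'` is an independent copy, on the same probability space, of the sequence `ε`: as random
elements of `S^ℤ` the two sequences have the same law and are independent. -/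
structure IsIndepCopy (P : Measure Ω) (ε ε' : ℤ → Ω → S) : Prop where
  measurable : ∀ t, Measurable (ε' t)
  identDistrib : IdentDistrib (fun ω t => ε' t ω) (fun ω t => ε t ω) P P
  indep : IndepFun (fun ω t => ε t ω) (fun ω t => ε' t ω) P

/-- The sequence `ε_{t,I}`: equal to `ε'_t` if `t ∈ I` and to `ε_t` if `t ∉ I`. -/
def coupled (ε ε' : ℤ → Ω → S) (I : Set ℤ) (t : ℤ) : Ω → S :=
  open Classical in if t ∈ I then ε' t else ε t

/-- The σ-algebra `𝒢_{t,I} = σ(ε_{t,I}, ε_{t-1,I}, …)`. -/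
@[reducible]
def coupledPast (ε ε' : ℤ → Ω → S) (t : ℤ) (I : Set ℤ) : MeasurableSpace Ω :=
  ⨆ (s : ℤ) (_ : s ≤ t), MeasurableSpace.comap (coupled ε ε' I s) inferInstance

/-- The dependence coefficient `ν_{X,ℍ,p}(j₁,…,j_k)`, the `L^p_H`-norm of
`X₀ + ∑_{i=1}^k (-1)^i ∑_{l₁<⋯<l_i} E[X₀ | 𝒢_{0,{-j_{l₁},…,-j_{l_i}}}]`.
The inner sum runs over the `i`-element sets `L = {l₁ < ⋯ < l_i}` of indices. -/
def depCoeff [NormedAddCommGroup H] [NormedSpace ℝ H] [CompleteSpace H]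
    (P : Measure Ω) (ε ε' : ℤ → Ω → S) (X : ℤ → Ω → H) (p : ℝ≥0∞) {k : ℕ}
    (j : Fin k → ℕ) : ℝ≥0∞ :=
  eLpNorm (fun ω => X 0 ω + ∑ i ∈ Finset.Icc 1 k, (-1 : ℝ) ^ i •
    ∑ L ∈ Finset.powersetCard i (Finset.univ : Finset (Fin k)),
      (P[X 0 | coupledPast ε ε' 0 ((fun l => -(j l : ℤ)) '' (L : Set (Fin k)))]) ω) p P

end Dependence

section Tensor

variable (𝕜 : Type*) [RCLike 𝕜] (H : Type*) [NormedAddCommGroup H] [InnerProductSpace 𝕜 H]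

/-- Tensors over `H` with index set `ι`, as bounded multilinear functionals on the dual (i.e. the
conjugate Hilbert space) of `H`. The Hilbert tensor product `⊗_{i ∈ ι} H` consists of those with
finite Hilbert–Schmidt norm `hsNorm`. -/
abbrev Tensor (ι : Type*) : Type _ :=
  ContinuousMultilinearMap 𝕜 (fun _ : ι => StrongDual 𝕜 H) 𝕜

variable {H}

/-- The elementary tensor `⊗_i x_i`, i.e. `(f_i)_i ↦ ∏_i f_i (x_i)`. -/
def simpleTensor {ι : Type*} [Fintype ι] (x : ι → H) : Tensor 𝕜 H ι :=
  (ContinuousMultilinearMap.mkPiAlgebra 𝕜 ι 𝕜).compContinuousLinearMap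
    (fun i => ContinuousLinearMap.apply 𝕜 𝕜 (x i))

/-- The mixed moment `E[⊗_i Y_i]` (a Bochner integral). -/
def momentTensor {Ω : Type*} [MeasurableSpace Ω] (P : Measure Ω) {ι : Type*} [Fintype ι]
    (Y : ι → Ω → H) : Tensor 𝕜 H ι :=
  ∫ ω, simpleTensor 𝕜 (fun i => Y i ω) ∂P

variable {𝕜}

/-- Changing the coordinate `i` of a family changes it on exactly one block of a partition. -/
theorem blockTensor_aux {ι M : Type*} [Fintype ι] [DecidableEq ι]
    (v : Finpartition (Finset.univ : Finset ι)) (f : ι → M) (i : ι) :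
    ∃ C ∈ v.parts, ∃ hi : i ∈ C,
      (∀ x : M, (fun k : C => Function.update f i x (k : ι)) =
        Function.update (fun k : C => f k) ⟨i, hi⟩ x) ∧
      ∀ B ∈ v.parts.erase C, ∀ x : M,
        (fun k : B => Function.update f i x (k : ι)) = fun k : B => f k := by
  obtain ⟨C, hC, hi⟩ := v.exists_mem (Finset.mem_univ i)
  refine ⟨C, hC, hi, fun x => ?_, fun B hB x => ?_⟩
  · funext k
    by_cases h : (k : ι) = i
    · have hk : k = ⟨i, hi⟩ := Subtype.ext h
      subst hk
      simp
    · have hk : k ≠ ⟨i, hi⟩ := fun hk => h (congrArg Subtype.val hk)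
      simp [Function.update_of_ne, h, hk]
  · funext k
    have h : (k : ι) ≠ i := by
      intro h
      refine (Finset.mem_erase.1 hB).1 (v.disjoint.elim_finset (Finset.mem_erase.1 hB).2 hC i ?_ hi)
      exact h ▸ k.2
    simp [Function.update_of_ne, h]

/-- For a partition `v` of `ι` and tensors `A_B` over the blocks `B` of `v`, the tensor product
`⊗_B A_B` with its components put back into their original positions: the value at `(f_i)_i` is
`∏_B A_B ((f_i)_{i ∈ B})`. -/
def blockTensor {ι : Type*} [Fintype ι] [dec : DecidableEq ι]
    (v : Finpartition (Finset.univ : Finset ι))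
    (A : (B : Finset ι) → Tensor 𝕜 H B) : Tensor 𝕜 H ι where
  toFun f := ∏ B ∈ v.parts, A B (fun i => f i)
  map_update_add' := by
    intro inst f i x y
    obtain rfl : dec = inst := Subsingleton.elim _ _
    obtain ⟨C, hC, hi, h₁, h₂⟩ := blockTensor_aux v f i
    simp only [← Finset.mul_prod_erase v.parts _ hC, h₁, ContinuousMultilinearMap.map_update_add,
      add_mul]
    congr 2 <;>
    · refine Finset.prod_congr rfl fun B hB => ?_
      rw [h₂ B hB, h₂ B hB]
  map_update_smul' := by
    intro inst f i c x
    obtain rfl : dec = inst := Subsingleton.elim _ _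
    obtain ⟨C, hC, hi, h₁, h₂⟩ := blockTensor_aux v f i
    simp only [← Finset.mul_prod_erase v.parts _ hC, h₁, ContinuousMultilinearMap.map_update_smul,
      smul_eq_mul, mul_assoc]
    congr 2
    refine Finset.prod_congr rfl fun B hB => ?_
    rw [h₂ B hB, h₂ B hB]
  cont := by
    refine continuous_finsetProd _ fun B _ => (A B).cont.comp ?_
    exact continuous_pi fun i => continuous_apply (i : ι)

variable (𝕜)

/-- The joint cumulant tensor
`cum(Y_i; i ∈ ι) = ∑_v (-1)^{|v|-1} (|v|-1)! Π_v (⊗_{B ∈ v} E[⊗_{i ∈ B} Y_i])`,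
the sum being over all unordered partitions `v` of `ι` into nonempty blocks. -/
def cumulant {Ω : Type*} [MeasurableSpace Ω] (P : Measure Ω) {ι : Type*} [Fintype ι]
    [DecidableEq ι] (Y : ι → Ω → H) : Tensor 𝕜 H ι :=
  ∑ v : Finpartition (Finset.univ : Finset ι),
    ((-1 : 𝕜) ^ (v.parts.card - 1) * ((v.parts.card - 1)! : 𝕜)) •
      blockTensor v (fun B => momentTensor 𝕜 P (fun i : B => Y i))

variable {𝕜}

/-- The Hilbert–Schmidt norm `(∑_κ |A(e_{κ(1)},…,e_{κ(n)})|²)^{1/2}` of a tensor (possibly `∞`),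
computed in an orthonormal basis `b` of `H`, where `e_a = ⟨b_a, ·⟩`. The value does not depend
on `b`. -/
def hsNorm {α ι : Type*} (b : HilbertBasis α 𝕜 H) (A : Tensor 𝕜 H ι) : ℝ≥0∞ :=
  (∑' κ : ι → α, ‖A (fun i => innerSL 𝕜 (b (κ i)))‖ₑ ^ 2) ^ (1 / 2 : ℝ)

end Tensor

end FunctionalCumulant

end

noncomputable section

set_option linter.unusedSectionVars false

namespace FunctionalCumulant

-- Let `M` be the order of the cumulant and `ω` a primitive `M`-th root of unity. By Good's formula
-- (`sum_copies_eq_sum_finpartition`, `integral_prod_copies`), `M` times the cumulant is the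
-- expectation of the product of the variables `∑ₐ ωᵃ Y_i⁽ᵃ⁾` built from `M` independent copies of
-- the noise. Rotating the copies multiplies each such variable by `ω⁻¹`. Hence the expectation
-- vanishes as soon as a proper nonempty subfamily `C` of the factors is made independent of the
-- rest (`integral_decoupled_eq_zero`).
--
-- Decoupling is done site by site: the factors in `C` get a fresh innovation at one site `s` after
-- another. Exchanging old and new innovation at `s` preserves the law, so the error of one step is
-- half the expectation of a second-order difference. It is a sum over `u ∈ C`, `j ∉ C` of terms in
-- which both factors `u` and `j` are differenced at `s` (`integral_piecewise_sub`). Adding `j` to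
-- `C` and iterating grows a tree whose edges carry sites; when all vertices are reached, Hölder's
-- inequality ends the recursion. The result, `enorm_integral_le_growthSum`, bounds the cumulant by
-- a sum over labelled trees of products over the vertices of the `L^M` norms of iterated
-- differences at the incident sites. It is proved for functionals of finitely many sites and
-- extended by conditional averaging. Applying it to finitely many Hilbert coordinates at once, with
-- constants independent of their number, bounds the Hilbert–Schmidt norm (`hsNorm_cumulant_le`).
--
-- Conditioning `X₀` on `𝒢_{0,I}` integrates out the sites of `I` (`condExp_coupledPast`). An
-- iterated difference kills every conditional expectation that forgets one of its sites, so it is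
-- controlled by the dependence coefficient (`diffNorm_le_depCoeff`).
--
-- Finally, by stationarity only differences "time of a vertex minus site of an incident edge"
-- matter. With one time fixed, a tree is determined by these differences, so the sum over times and
-- sites is at most a product of one sum per vertex (`tsum_growth_le`). A vertex has at most `M - 1
-- ≤ n - 1` edges, and each of these sums is dominated by the assumed one (`tsum_weight_lt_top`).

universe u

/-! ### Good's formula: cumulant weights as character sums. -/

section RootsOfUnity

variable {R : Type*} [CommRing R] [IsDomain R]

theorem sum_rootOfUnity_pow {M : ℕ} {ω : R} (hω : IsPrimitiveRoot ω M) {b : ℕ} (hb : 0 < b)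
    (hbM : b < M) : ∑ k : Fin M, ω ^ (b * (k : ℕ)) = 0 := by
  have h1 : ω ^ b ≠ 1 := fun h => (Nat.le_of_dvd hb (hω.dvd_of_pow_eq_one b h)).not_gt hbM
  have h2 := mul_geom_sum (ω ^ b) M
  rw [← pow_mul, mul_comm b M, pow_mul, hω.pow_eq_one, one_pow, sub_self] at h2
  rw [Fin.sum_univ_eq_sum_range (fun k => ω ^ (b * k))]
  simpa [pow_mul, sub_ne_zero.2 h1] using h2

/-- Character sums over injective maps: the block weights of a cumulant. -/
theorem sum_injective_rootOfUnity {M : ℕ} {ω : R} (hω : IsPrimitiveRoot ω M) (r : ℕ)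
    (b : Fin (r + 1) → ℕ) (hb : ∀ i, 0 < b i) (hsum : ∑ i, b i = M) :
    (∑ k : Fin (r + 1) → Fin M with Function.Injective k, ∏ i, ω ^ (b i * (k i : ℕ))) =
      M * ((-1) ^ r * (r ! : R)) := by
  induction r with
  | zero =>
    have hb0 : b 0 = M := by simpa using hsum
    have : ∀ k : Fin 1 → Fin M, Function.Injective k := fun k =>
      Function.injective_of_subsingleton k
    simp [this, hb0, pow_mul, hω.pow_eq_one]
  | succ r ih =>
    -- Block `0` is labelled last, by a label the others miss. The full character sum vanishes as `b
    -- 0 < M`, so this sum is minus the sum over the labels already used; each of those `r + 1`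
    -- terms merges block `0` with another block, which produces the factorial.
    have h1 : (∑ k : Fin (r + 2) → Fin M with Function.Injective k,
        ∏ i, ω ^ (b i * (k i : ℕ))) =
        ∑ k : Fin (r + 1) → Fin M with Function.Injective k,
          (∏ i, ω ^ (b i.succ * (k i : ℕ))) *
            ∑ a : Fin M with a ∉ Set.range k, ω ^ (b 0 * (a : ℕ)) := by
      simp only [Finset.mul_sum, Finset.sum_filter]
      rw [← (Fin.consEquiv (fun _ : Fin (r + 2) => Fin M)).sum_comp, Fintype.sum_prod_type,
        Finset.sum_comm]
      refine Finset.sum_congr rfl fun k _ => ?_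
      split_ifs with hk
      · refine Finset.sum_congr rfl fun a _ => ?_
        simp [Fin.consEquiv, Fin.cons_injective_iff, hk, Fin.prod_univ_succ, mul_comm]
      · refine Finset.sum_eq_zero fun a _ => ?_
        simp [Fin.consEquiv, Fin.cons_injective_iff, hk]
    have h0 : b 0 < M := by
      have := hb 1
      rw [← hsum, Fin.sum_univ_succ, Fin.sum_univ_succ]
      simp at this ⊢
      omega
    have h2 : ∀ k : Fin (r + 1) → Fin M, Function.Injective k →
        ∑ a : Fin M with a ∉ Set.range k, ω ^ (b 0 * (a : ℕ)) =
          - ∑ l, ω ^ (b 0 * (k l : ℕ)) := by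
      intro k hk
      have hs := Finset.sum_filter_add_sum_filter_not Finset.univ (fun a => a ∈ Set.range k)
        (fun a : Fin M => ω ^ (b 0 * (a : ℕ)))
      rw [sum_rootOfUnity_pow hω (hb 0) h0] at hs
      have : (Finset.univ.filter fun a => a ∈ Set.range k) = Finset.univ.image k := by
        ext; simp
      rw [this, Finset.sum_image (fun _ _ _ _ h => hk h)] at hs
      linear_combination hs
    have h3 : ∀ l : Fin (r + 1), (∑ k : Fin (r + 1) → Fin M with Function.Injective k,
        (∏ i, ω ^ (b i.succ * (k i : ℕ))) * ω ^ (b 0 * (k l : ℕ))) =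
          M * ((-1) ^ r * (r ! : R)) := by
      intro l
      -- Block `0` is absorbed into block `l`, so the total weight is still `M`.
      rw [← ih (fun i => b i.succ + if i = l then b 0 else 0) (fun i => by have := hb i.succ; omega)
        (by rw [Finset.sum_add_distrib, ← hsum, Fin.sum_univ_succ b]; simp [add_comm])]
      refine Finset.sum_congr rfl fun k _ => ?_
      simp only [add_mul, pow_add, Finset.prod_mul_distrib, ite_mul, zero_mul, pow_ite, pow_zero]
      simp
    rw [h1, Finset.sum_congr rfl fun k hk => by rw [h2 k (Finset.mem_filter.1 hk).2, mul_neg,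
      Finset.mul_sum], Finset.sum_neg_distrib, Finset.sum_comm,
      Finset.sum_congr rfl fun l _ => h3 l]
    simp [Nat.factorial_succ]
    ring

theorem sum_embedding_rootOfUnity {M : ℕ} {ω : R} (hω : IsPrimitiveRoot ω M) {β : Type*}
    [Fintype β] [DecidableEq β] [Nonempty β] (b : β → ℕ) (hb : ∀ i, 0 < b i) (hsum : ∑ i, b i = M) :
    (∑ k : β ↪ Fin M, ∏ i, ω ^ (b i * (k i : ℕ))) =
      M * ((-1) ^ (Fintype.card β - 1) * ((Fintype.card β - 1)! : R)) := by
  obtain ⟨r, hr⟩ : ∃ r, Fintype.card β = r + 1 :=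
    ⟨_, (Nat.succ_pred_eq_of_pos Fintype.card_pos).symm⟩
  let e : Fin (r + 1) ≃ β := (Fintype.equivFinOfCardEq hr).symm
  rw [hr, Nat.add_sub_cancel, ← sum_injective_rootOfUnity hω r (fun i => b (e i)) (fun i => hb _)
    (by rw [← hsum]; exact e.sum_comp b)]
  refine Finset.sum_bij (fun k _ => fun i => k (e i)) (fun k _ => ?_) (fun k _ k' _ h => ?_)
    (fun k hk => ?_) (fun k _ => ?_)
  · exact Finset.mem_filter.2 ⟨Finset.mem_univ _, k.injective.comp e.injective⟩
  · ext x
    have := congrFun h (e.symm x)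
    simp at this
    rw [this]
  · refine ⟨⟨fun x => k (e.symm x), (Finset.mem_filter.1 hk).2.comp e.symm.injective⟩, by simp, ?_⟩
    ext; simp
  · exact (e.prod_comp (fun i => ω ^ (b i * (k i : ℕ)))).symm

variable {ι : Type*} [Fintype ι] [DecidableEq ι]

/-- A map out of `ι` is the same thing as a partition of `ι` with an injective labelling of its
blocks. -/
def labelling (κ : Type*) :
    (Σ v : Finpartition (Finset.univ : Finset ι), (v.parts ↪ κ)) → (ι → κ) :=
  fun x i => x.2 ⟨x.1.part i, x.1.part_mem.2 (Finset.mem_univ i)⟩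

theorem part_eq_part_iff (v : Finpartition (Finset.univ : Finset ι)) (i j : ι) :
    v.part i = v.part j ↔ i ∈ v.part j :=
  (v.mem_part_iff_part_eq_part (Finset.mem_univ i) (Finset.mem_univ j)).symm

theorem labelling_eq_iff {κ : Type*} (v : Finpartition (Finset.univ : Finset ι)) (k : v.parts ↪ κ)
    (i j : ι) : labelling κ ⟨v, k⟩ i = labelling κ ⟨v, k⟩ j ↔ i ∈ v.part j := by
  rw [← part_eq_part_iff]
  simp [labelling]

/-- The inverse takes the fibres of a map as blocks. A sum over assignments of copies thus splits
into a sum over partitions and, for each of them, a character sum over injective labellings. -/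
theorem labelling_bijective (κ : Type*) : Function.Bijective (labelling (ι := ι) κ) := by
  classical
  constructor
  · rintro ⟨v, k⟩ ⟨v', k'⟩ h
    have hp : ∀ i, v.part i = v'.part i := by
      intro i
      ext j
      rw [← labelling_eq_iff v k, ← labelling_eq_iff v' k', h]
    have hv : v = v' := by
      ext B
      constructor
      · intro hB
        obtain ⟨i, hi⟩ := v.nonempty_of_mem_parts hB
        rw [← v.part_eq_of_mem hB hi, hp]
        exact v'.part_mem.2 (Finset.mem_univ i)
      · intro hB
        obtain ⟨i, hi⟩ := v'.nonempty_of_mem_parts hB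
        rw [← v'.part_eq_of_mem hB hi, ← hp]
        exact v.part_mem.2 (Finset.mem_univ i)
    subst hv
    congr 1
    ext ⟨B, hB⟩
    obtain ⟨i, hi⟩ := v.nonempty_of_mem_parts hB
    have := congrFun h i
    simp only [labelling, v.part_eq_of_mem hB hi] at this
    exact this
  · intro c
    let v := Finpartition.ofSetoid (Setoid.ker c)
    have hv : ∀ i j, j ∈ v.part i ↔ c i = c j := fun i j =>
      Finpartition.mem_part_ofSetoid_iff_rel
    choose f hf using fun B : v.parts => v.nonempty_of_mem_parts B.2
    refine ⟨⟨v, ⟨fun B => c (f B), fun B B' h => ?_⟩⟩, ?_⟩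
    · have := (hv (f B) (f B')).2 h
      rw [v.part_eq_of_mem B.2 (hf B)] at this
      exact Subtype.ext (v.eq_of_mem_parts B.2 B'.2 this (hf B'))
    · ext i
      exact ((hv i _).1 (hf ⟨v.part i, _⟩)).symm

/-- Labels that are not used have empty fibre and contribute `Mo ∅ = 1`. -/
theorem prod_fiber_labelling {κ : Type*} [Fintype κ] [DecidableEq κ]
    (v : Finpartition (Finset.univ : Finset ι)) (k : v.parts ↪ κ) (Mo : Finset ι → R)
    (h0 : Mo ∅ = 1) :
    ∏ a : κ, Mo {i | labelling κ ⟨v, k⟩ i = a} = ∏ B ∈ v.parts, Mo B := by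
  classical
  have hk : ∀ B : v.parts, ({i | labelling κ ⟨v, k⟩ i = k B} : Finset ι) = B := by
    intro B
    ext i
    simp only [Finset.mem_filter, Finset.mem_univ, true_and]
    exact k.injective.eq_iff.trans (Subtype.ext_iff.trans (v.part_eq_iff_mem B.2))
  rw [← Finset.prod_subset (Finset.subset_univ (Finset.univ.image k)), Finset.prod_image
    (fun _ _ _ _ h => k.injective h), Finset.prod_congr rfl fun B _ => by rw [hk B]]
  · exact Finset.prod_coe_sort v.parts Mo
  · intro a _ ha
    rw [← h0]
    congr 1
    ext i
    simp only [Finset.mem_filter, Finset.mem_univ, true_and, Finset.notMem_empty, iff_false]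
    intro h
    exact ha (Finset.mem_image.2 ⟨_, Finset.mem_univ _, h⟩)

/-- Good's formula: the alternating sum over partitions defining a cumulant is a discrete Fourier
coefficient of the moments of independent copies. -/
theorem sum_copies_eq_sum_finpartition [Nonempty ι] {M : ℕ} (hM : Fintype.card ι = M) {ω : R}
    (hω : IsPrimitiveRoot ω M) (Mo : Finset ι → R) (h0 : Mo ∅ = 1) :
    ∑ c : ι → Fin M, (∏ i, ω ^ (c i : ℕ)) * ∏ a, Mo {i | c i = a} =
      M * ∑ v : Finpartition (Finset.univ : Finset ι),
        ((-1) ^ (v.parts.card - 1) * ((v.parts.card - 1)! : R)) * ∏ B ∈ v.parts, Mo B := by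
  rw [← (labelling_bijective (ι := ι) (Fin M)).sum_comp, Fintype.sum_sigma, Finset.mul_sum]
  refine Finset.sum_congr rfl fun v _ => ?_
  simp only [prod_fiber_labelling v _ Mo h0]
  rw [← Finset.sum_mul, ← mul_assoc]
  congr 1
  have hne : Nonempty v.parts := by
    obtain ⟨i⟩ := ‹Nonempty ι›
    exact ⟨⟨v.part i, v.part_mem.2 (Finset.mem_univ i)⟩⟩
  rw [← Fintype.card_coe v.parts,
    ← sum_embedding_rootOfUnity hω (fun B : v.parts => (B : Finset ι).card)
    (fun B => Finset.card_pos.2 (v.nonempty_of_mem_parts B.2))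
    (by rw [Finset.sum_coe_sort v.parts Finset.card, v.sum_card_parts, Finset.card_univ, hM])]
  refine Finset.sum_congr rfl fun k _ => ?_
  have : ∀ B : v.parts, ω ^ ((B : Finset ι).card * (k B : ℕ)) =
      ∏ i with (⟨v.part i, v.part_mem.2 (Finset.mem_univ i)⟩ : v.parts) = B,
        ω ^ (labelling (Fin M) ⟨v, k⟩ i : ℕ) := by
    intro B
    rw [Finset.prod_congr rfl (g := fun _ => ω ^ (k B : ℕ))]
    · rw [Finset.prod_const, ← pow_mul, mul_comm]
      congr 2
      congr 1
      ext i
      simp only [Finset.mem_filter, Finset.mem_univ, true_and, Subtype.ext_iff]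
      exact (v.part_eq_iff_mem B.2).symm
    · intro i hi
      simp only [labelling]
      rw [(Finset.mem_filter.1 hi).2]
  simp only [this]
  exact (Finset.prod_fiberwise Finset.univ _ _).symm

end RootsOfUnity

/-! ### Resampling at sites and iterated differences. -/

section Sites

variable {T : Type*} [MeasurableSpace T]

/-- The law of a sequence, indexed by `ℤ`, of independent elements of law `ρ`. -/
abbrev siteMeasure (ρ : Measure T) : Measure (ℤ → T) := Measure.infinitePi fun _ => ρ

/-- The law of a pair of independent elements of law `ρ`. -/
abbrev pairMeasure (ρ : Measure T) : Measure (Fin 2 → T) := Measure.infinitePi fun _ => ρ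

theorem measurePreserving_infinitePi_map {ι : Type*} {X Y : ι → Type*}
    [∀ i, MeasurableSpace (X i)] [∀ i, MeasurableSpace (Y i)] {μ : ∀ i, Measure (X i)}
    {ν : ∀ i, Measure (Y i)} [∀ i, IsProbabilityMeasure (μ i)] {q : ∀ i, X i → Y i}
    (hq : ∀ i, MeasurePreserving (q i) (μ i) (ν i)) :
    MeasurePreserving (fun x i => q i (x i)) (Measure.infinitePi μ) (Measure.infinitePi ν) where
  measurable := measurable_pi_lambda _ fun i => (hq i).measurable.comp (measurable_pi_apply i)
  map_eq := by
    rw [Measure.infinitePi_map_pi μ fun i => (hq i).measurable]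
    simp only [(hq _).map_eq]

theorem measurePreserving_infinitePi_comp {ι κ : Type*} (ρ : Measure T) [IsProbabilityMeasure ρ]
    {f : κ → ι} (hf : Function.Injective f) :
    MeasurePreserving (fun (x : ι → T) k => x (f k)) (Measure.infinitePi fun _ => ρ)
      (Measure.infinitePi fun _ => ρ) where
  measurable := measurable_pi_lambda _ fun _ => measurable_pi_apply _
  map_eq := Measure.map_infinitePi_infinitePi_of_inj hf

theorem integral_comp_measurePreserving {α β E : Type*} [MeasurableSpace α] [MeasurableSpace β]
    [NormedAddCommGroup E] [NormedSpace ℝ E] {μ : Measure α} {ν : Measure β} {f : α → β}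
    (hf : MeasurePreserving f μ ν) {g : β → E} (hg : AEStronglyMeasurable g ν) :
    ∫ x, g (f x) ∂μ = ∫ y, g y ∂ν := by
  rw [← hf.map_eq] at hg ⊢
  exact (integral_map hf.measurable.aemeasurable hg).symm

/-- From a sequence of pairs, select the second member of the pair at the sites in `B` and the
first one elsewhere. -/
def sel (B : Finset ℤ) (z : ℤ → Fin 2 → T) : ℤ → T := fun s => z s (if s ∈ B then 1 else 0)

theorem measurePreserving_sel (ρ : Measure T) [IsProbabilityMeasure ρ] (B : Finset ℤ) :
    MeasurePreserving (sel B) (siteMeasure (pairMeasure ρ)) (siteMeasure ρ) :=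
  measurePreserving_infinitePi_map fun _ => measurePreserving_eval_infinitePi _ _

/-- Exchange the two members of the pairs at the sites in `B`. -/
def swapAt (B : Finset ℤ) (z : ℤ → Fin 2 → T) : ℤ → Fin 2 → T :=
  fun s a => z s (if s ∈ B then Equiv.swap 0 1 a else a)

theorem measurePreserving_swapAt (ρ : Measure T) [IsProbabilityMeasure ρ] (B : Finset ℤ) :
    MeasurePreserving (swapAt B) (siteMeasure (pairMeasure ρ)) (siteMeasure (pairMeasure ρ)) := by
  refine measurePreserving_infinitePi_map
    (q := fun s (y : Fin 2 → T) a => y (if s ∈ B then Equiv.swap 0 1 a else a)) fun s =>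
    measurePreserving_infinitePi_comp ρ ?_
  by_cases h : s ∈ B
  · simpa [h] using (Equiv.swap (0 : Fin 2) 1).injective
  · simp only [h, if_false]
    exact fun _ _ h => h

theorem sel_swapAt_of_notMem {s : ℤ} {B : Finset ℤ} (hs : s ∉ B) (z : ℤ → Fin 2 → T) :
    sel B (swapAt {s} z) = sel (insert s B) z := by
  funext r
  by_cases h : r = s
  · subst h; simp [sel, swapAt, hs]
  · simp [sel, swapAt, h]

theorem sel_insert_swapAt {s : ℤ} {B : Finset ℤ} (hs : s ∉ B) (z : ℤ → Fin 2 → T) :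
    sel (insert s B) (swapAt {s} z) = sel B z := by
  funext r
  by_cases h : r = s
  · subst h; simp [sel, swapAt, hs]
  · simp [sel, swapAt, h]

variable {E : Type*} [NormedAddCommGroup E]

/-- The iterated difference of `U` at the sites of `A`, with respect to an independent copy. -/
def diff (A : Finset ℤ) (U : (ℤ → T) → E) (z : ℤ → Fin 2 → T) : E :=
  ∑ B ∈ A.powerset, (-1 : ℤ) ^ B.card • U (sel B z)

/-- The `L^p`-norm of the iterated difference of `U` at the sites of `A`. -/
def diffNorm (ρ : Measure T) (p : ℝ≥0∞) (A : Finset ℤ) (U : (ℤ → T) → E) : ℝ≥0∞ :=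
  eLpNorm (diff A U) p (siteMeasure (pairMeasure ρ))

variable {ρ : Measure T} [IsProbabilityMeasure ρ] {p : ℝ≥0∞} {U : (ℤ → T) → E}

theorem aestronglyMeasurable_diff (hU : AEStronglyMeasurable U (siteMeasure ρ)) (A : Finset ℤ) :
    AEStronglyMeasurable (diff A U) (siteMeasure (pairMeasure ρ)) := by
  refine Finset.aestronglyMeasurable_fun_sum _ fun B _ => ?_
  exact (hU.comp_measurePreserving (measurePreserving_sel ρ B)).const_smul ((-1 : ℤ) ^ B.card)

theorem diffNorm_empty (hU : AEStronglyMeasurable U (siteMeasure ρ)) :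
    diffNorm ρ p ∅ U = eLpNorm U p (siteMeasure ρ) := by
  rw [← eLpNorm_comp_measurePreserving hU (measurePreserving_sel ρ ∅)]
  rw [diffNorm]
  congr 1
  funext z
  simp [diff]

theorem diff_insert {s : ℤ} {A : Finset ℤ} (hs : s ∉ A) (U : (ℤ → T) → E) (z : ℤ → Fin 2 → T) :
    diff (insert s A) U z =
      ∑ B ∈ A.powerset, (-1 : ℤ) ^ B.card • (U (sel B z) - U (sel (insert s B) z)) := by
  rw [diff, Finset.sum_powerset_insert hs, ← Finset.sum_add_distrib]
  refine Finset.sum_congr rfl fun B hB => ?_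
  rw [Finset.card_insert_of_notMem fun h => hs (Finset.mem_powerset.1 hB h), pow_succ, smul_sub,
    mul_neg_one, neg_smul, sub_eq_add_neg]

/-- The terms of `B` and `insert s B` cancel in pairs. -/
theorem diff_eq_zero {s : ℤ} {A : Finset ℤ} (hs : s ∈ A) (hU : DependsOn U {s}ᶜ) :
    diff A U = 0 := by
  funext z
  rw [← Finset.insert_erase hs, diff_insert (Finset.notMem_erase s A)]
  refine Finset.sum_eq_zero fun B _ => ?_
  rw [hU (x := sel B z) (y := sel (insert s B) z), sub_self, smul_zero]
  intro r hr
  have : r ≠ s := hr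
  simp [sel, this]

theorem measurePreserving_selPair (ρ : Measure T) [IsProbabilityMeasure ρ] (B : Finset ℤ) :
    MeasurePreserving (fun (y : ℤ → Fin 2 → Fin 2 → T) s a => y s a (if s ∈ B then 1 else 0))
      (siteMeasure (pairMeasure (pairMeasure ρ))) (siteMeasure (pairMeasure ρ)) :=
  measurePreserving_infinitePi_map
    (q := fun s (w : Fin 2 → Fin 2 → T) a => w a (if s ∈ B then 1 else 0)) fun s =>
    measurePreserving_infinitePi_map
      (q := fun _ (v : Fin 2 → T) => v (if s ∈ B then 1 else 0)) fun _ =>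
        measurePreserving_eval_infinitePi _ _

/-- Selecting one member at each site from a pair of i.i.d. pairs leaves an i.i.d. pair. -/
theorem diffNorm_comp_sel (hU : AEStronglyMeasurable U (siteMeasure ρ)) (A B : Finset ℤ) :
    diffNorm (pairMeasure ρ) p A (U ∘ sel B) = diffNorm ρ p A U := by
  rw [diffNorm, diffNorm, ← eLpNorm_comp_measurePreserving (aestronglyMeasurable_diff hU A)
    (measurePreserving_selPair ρ B)]
  rfl

theorem diff_sub (A : Finset ℤ) (U V : (ℤ → T) → E) : diff A (U - V) = diff A U - diff A V := by
  funext z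
  simp [diff, smul_sub, Finset.sum_sub_distrib]

/-- If `s ∉ A`, changing the selection at `s` is one further difference, and equality holds without
the factor. If `s ∈ A` the site is already differenced, and the triangle inequality costs the factor
`2`. -/
theorem diffNorm_comp_sel_sub (hp : 1 ≤ p) (hU : AEStronglyMeasurable U (siteMeasure ρ))
    (A : Finset ℤ) {B : Finset ℤ} {s : ℤ} (hs : s ∉ B) :
    diffNorm (pairMeasure ρ) p A (U ∘ sel B - U ∘ sel (insert s B)) ≤
      2 * diffNorm ρ p (insert s A) U := by
  by_cases hA : s ∈ A
  · rw [Finset.insert_eq_of_mem hA, two_mul]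
    nth_rw 1 [← diffNorm_comp_sel hU A B]
    rw [← diffNorm_comp_sel hU A (insert s B), diffNorm, diff_sub]
    have h (B) := aestronglyMeasurable_diff
      (hU.comp_measurePreserving (measurePreserving_sel ρ B)) A
    exact eLpNorm_sub_le (h _) (h _) hp
  · refine le_trans (le_of_eq ?_) (le_mul_of_one_le_left' one_le_two)
    -- The outer index belongs to the difference over `A`, the inner one to the selection by `B`. At
    -- `s ∉ A` only the outer member `0` is read, and its two inner members serve as the pair.
    have hmp : MeasurePreserving (fun (y : ℤ → Fin 2 → Fin 2 → T) r a =>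
        if r = s then y r 0 a else y r a (if r ∈ B then 1 else 0))
        (siteMeasure (pairMeasure (pairMeasure ρ))) (siteMeasure (pairMeasure ρ)) := by
      refine measurePreserving_infinitePi_map
        (q := fun r (w : Fin 2 → Fin 2 → T) a =>
          if r = s then w 0 a else w a (if r ∈ B then 1 else 0)) fun r => ?_
      by_cases hr : r = s
      · simpa [hr] using measurePreserving_eval_infinitePi (fun _ : Fin 2 => pairMeasure ρ) 0
      · simp only [hr, if_false]
        exact measurePreserving_infinitePi_map
          (q := fun _ (v : Fin 2 → T) => v (if r ∈ B then 1 else 0)) fun _ =>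
            measurePreserving_eval_infinitePi _ _
    rw [diffNorm, diffNorm, ← eLpNorm_comp_measurePreserving (aestronglyMeasurable_diff hU _) hmp]
    congr 1
    funext y
    rw [Function.comp_apply, diff_insert hA, diff]
    refine Finset.sum_congr rfl fun D hD => ?_
    have hD' : s ∉ D := fun h => hA (Finset.mem_powerset.1 hD h)
    simp only [Pi.sub_apply, Function.comp_apply]
    congr 3
    all_goals
      funext r
      by_cases hr : r = s
      · subst hr; simp [sel, hs, hD']
      · simp [sel, hr]

end Sites

/-! ### Hölder bounds for integrals of multilinear maps. -/

section Holder

variable {α ι E G : Type*} [MeasurableSpace α] {μ : Measure α} [Fintype ι]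
  [NormedAddCommGroup E] [NormedAddCommGroup G]

theorem aestronglyMeasurable_pi [SecondCountableTopology E] {U : ι → α → E}
    (hU : ∀ i, AEStronglyMeasurable (U i) μ) : AEStronglyMeasurable (fun x i => U i x) μ := by
  borelize E
  exact (aemeasurable_pi_lambda _ fun i => (hU i).aemeasurable).aestronglyMeasurable

theorem lintegral_prod_enorm_le {M : ℕ} (hM : Fintype.card ι = M) (hM0 : M ≠ 0)
    {U : ι → α → E} (hU : ∀ i, AEStronglyMeasurable (U i) μ) :
    ∫⁻ x, ∏ i, ‖U i x‖ₑ ∂μ ≤ ∏ i, eLpNorm (U i) M μ := by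
  have hM' : (M : ℝ) ≠ 0 := by exact_mod_cast hM0
  have h := ENNReal.lintegral_prod_norm_pow_le (μ := μ) (Finset.univ : Finset ι)
    (f := fun i x => ‖U i x‖ₑ ^ (M : ℝ)) (fun i _ => (hU i).enorm.pow_const _)
    (p := fun _ => 1 / (M : ℝ)) (by simp [hM, hM']) (fun _ _ => by positivity)
  simp only [← ENNReal.rpow_mul, mul_one_div_cancel hM', ENNReal.rpow_one] at h
  refine h.trans (le_of_eq (Finset.prod_congr rfl fun i _ => ?_))
  rw [eLpNorm_eq_lintegral_rpow_enorm_toReal (by exact_mod_cast hM0) (by simp)]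
  simp

variable [NormedSpace ℂ E] [NormedSpace ℂ G]

theorem integrable_multilinear [SecondCountableTopology E]
    (m : ContinuousMultilinearMap ℂ (fun _ : ι => E) G)
    {M : ℕ} (hM : Fintype.card ι = M) (hM0 : M ≠ 0)
    {U : ι → α → E} (hU : ∀ i, MemLp (U i) M μ) :
    Integrable (fun x => m fun i => U i x) μ := by
  have hmeas : AEStronglyMeasurable (fun x => m fun i => U i x) μ :=
    m.cont.comp_aestronglyMeasurable (f := fun x i => U i x)
      (aestronglyMeasurable_pi fun i => (hU i).1)
  have hg : Integrable (fun x => ‖m‖ * ∏ i, ‖U i x‖) μ := by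
    refine Integrable.const_mul ⟨?_, ?_⟩ _
    · exact Finset.aestronglyMeasurable_fun_prod _ fun i _ => (hU i).1.norm
    · have : ∀ x, ‖∏ i, ‖U i x‖‖ₑ = ∏ i, ‖U i x‖ₑ := fun x => by
        rw [enorm_eq_nnnorm, nnnorm_prod]
        push_cast
        simp [enorm_eq_nnnorm]
      rw [HasFiniteIntegral, lintegral_congr this]
      exact (lintegral_prod_enorm_le hM hM0 fun i => (hU i).1).trans_lt
        (ENNReal.prod_lt_top fun i _ => (hU i).2)
  exact hg.mono' hmeas (Filter.Eventually.of_forall fun x => m.le_opNorm _)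

theorem enorm_integral_multilinear_le [CompleteSpace G]
    (m : ContinuousMultilinearMap ℂ (fun _ : ι => E) G)
    (hm : ∀ x, ‖m x‖ ≤ ∏ i, ‖x i‖)
    {M : ℕ} (hM : Fintype.card ι = M) (hM0 : M ≠ 0)
    {U : ι → α → E} (hU : ∀ i, AEStronglyMeasurable (U i) μ) :
    ‖∫ x, m (fun i => U i x) ∂μ‖ₑ ≤ ∏ i, eLpNorm (U i) M μ := by
  refine (enorm_integral_le_lintegral_enorm _).trans
    (le_trans (lintegral_mono fun x => ?_) (lintegral_prod_enorm_le hM hM0 hU))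
  have := hm fun i => U i x
  rw [enorm_eq_nnnorm]
  simp only [enorm_eq_nnnorm]
  exact_mod_cast (show ‖m fun i => U i x‖₊ ≤ ∏ i, ‖U i x‖₊ by
    rw [← NNReal.coe_le_coe]; push_cast; exact this)

end Holder

/-! ### Sums over trees with edges labelled by sites. -/

section Growth

variable {ι : Type*} [Fintype ι] [DecidableEq ι]

/-- `e` lists the edges `(u, j)` of a tree grown from the vertex set `C` up to all of `ι`, each step
joining a new vertex `j` to a vertex `u` already reached. -/
def IsGrowth : (k : ℕ) → Finset ι → (Fin k → ι × ι) → Prop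
  | 0, C, _ => C = Finset.univ
  | k + 1, C, e => (e 0).1 ∈ C ∧ (e 0).2 ∉ C ∧ IsGrowth k (insert (e 0).2 C) (Fin.tail e)

/-- The values of `s` on the edges at the vertex `i`. -/
def edgeSites {k : ℕ} (e : Fin k → ι × ι) (s : Fin k → ℤ) (i : ι) : Finset ℤ :=
  Finset.image s {l | (e l).1 = i ∨ (e l).2 = i}

theorem edgeSites_cons {k : ℕ} (e₀ : ι × ι) (e : Fin k → ι × ι) (s₀ : ℤ) (s : Fin k → ℤ) (i : ι) :
    edgeSites (Fin.cons e₀ e : Fin (k + 1) → ι × ι) (Fin.cons s₀ s : Fin (k + 1) → ℤ) i =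
      if e₀.1 = i ∨ e₀.2 = i then insert s₀ (edgeSites e s i) else edgeSites e s i := by
  ext r
  split_ifs with h
  · simp [edgeSites, Fin.exists_fin_succ, h, eq_comm (a := r)]
  · simp [edgeSites, Fin.exists_fin_succ, h]

open Classical in
/-- The sum, over all trees grown from `C` and all labellings of their edges by integers, of the
product over the vertices of weights depending on the labels at the vertex. -/
def growthSum (k : ℕ) (C : Finset ι) (N : ι → Finset ℤ → ℝ≥0∞) : ℝ≥0∞ :=
  ∑ e : Fin k → ι × ι with IsGrowth k C e, ∑' s : Fin k → ℤ, ∏ i, N i (edgeSites e s i)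

theorem growthSum_zero (N : ι → Finset ℤ → ℝ≥0∞) :
    growthSum 0 Finset.univ N = ∏ i, N i ∅ := by
  simp [growthSum, IsGrowth, edgeSites]

/-- The first edge is split off; its label enters the site sets of its two ends. This is the
recursion that one decoupling round produces. -/
theorem growthSum_succ (k : ℕ) (C : Finset ι) (N : ι → Finset ℤ → ℝ≥0∞) :
    growthSum (k + 1) C N = ∑' s : ℤ, ∑ u ∈ C, ∑ j ∈ Cᶜ, growthSum k (insert j C)
      (fun i A => if u = i ∨ j = i then N i (insert s A) else N i A) := by
  classical
  have h1 : ∀ e : Fin (k + 1) → ι × ι, ∑' s : Fin (k + 1) → ℤ, ∏ i, N i (edgeSites e s i) =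
      ∑' (s₀ : ℤ) (s : Fin k → ℤ), ∏ i,
        N i (edgeSites e (Fin.cons s₀ s : Fin (k + 1) → ℤ) i) := by
    intro e
    rw [← (Fin.consEquiv (fun _ : Fin (k + 1) => ℤ)).tsum_eq, ← ENNReal.tsum_prod]
    rfl
  simp only [growthSum, h1]
  rw [← Summable.tsum_finsetSum fun _ _ => ENNReal.summable]
  congr 1
  funext s₀
  simp only [Finset.sum_filter]
  rw [← (Fin.consEquiv (fun _ : Fin (k + 1) => ι × ι)).sum_comp, Fintype.sum_prod_type,
    Fintype.sum_prod_type]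
  have hC : ∀ f : ι → ℝ≥0∞, ∑ u ∈ C, f u = ∑ u, if u ∈ C then f u else 0 := fun f => by
    rw [← Finset.sum_filter]; simp
  have hC' : ∀ f : ι → ℝ≥0∞, ∑ u ∈ Cᶜ, f u = ∑ u, if u ∉ C then f u else 0 := fun f => by
    rw [← Finset.sum_filter]
    congr 1
    ext; simp
  rw [hC]
  refine Finset.sum_congr rfl fun u _ => ?_
  split_ifs with hu
  · rw [hC']
    refine Finset.sum_congr rfl fun j _ => ?_
    by_cases hj : j ∉ C
    · rw [if_pos hj]
      refine Finset.sum_congr rfl fun e _ => ?_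
      simp only [Fin.consEquiv, Equiv.coe_fn_mk, IsGrowth, Fin.cons_zero, Fin.tail_cons, hu, hj,
        not_false_eq_true, true_and, edgeSites_cons, apply_ite (N _)]
    · rw [if_neg hj]
      refine Finset.sum_eq_zero fun e _ => ?_
      simp only [not_not] at hj
      simp [Fin.consEquiv, IsGrowth, hj]
  · refine Finset.sum_eq_zero fun j _ => Finset.sum_eq_zero fun e _ => ?_
    simp [Fin.consEquiv, IsGrowth, hu]

theorem growthSum_mono {k : ℕ} {C : Finset ι} {N N' : ι → Finset ℤ → ℝ≥0∞}
    (h : ∀ i A, N i A ≤ N' i A) : growthSum k C N ≤ growthSum k C N' :=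
  Finset.sum_le_sum fun _ _ => ENNReal.tsum_le_tsum fun _ => Finset.prod_le_prod' fun _ _ => h _ _

theorem growthSum_const_mul (k : ℕ) (C : Finset ι) (N : ι → Finset ℤ → ℝ≥0∞) (a : ℝ≥0∞) :
    growthSum k C (fun i A => a * N i A) = a ^ Fintype.card ι * growthSum k C N := by
  simp [growthSum, Finset.prod_mul_distrib, ENNReal.tsum_mul_left, Finset.mul_sum]

end Growth

/-! ### Decoupling and the tree bound. -/

section Core

variable {ι E G : Type*} [Fintype ι] [LinearOrder ι] [NormedAddCommGroup E] [NormedSpace ℂ E]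
  [SecondCountableTopology E] [NormedAddCommGroup G] [NormedSpace ℂ G] [CompleteSpace G]

/-- Second-order difference of a multilinear map, the arguments being changed simultaneously in `C`
and in its complement. -/
theorem multilinear_piecewise_second_difference (m : ContinuousMultilinearMap ℂ (fun _ : ι => E) G)
    (C : Finset ι) (a a' b b' : ι → E) :
    (m (C.piecewise a b) - m (C.piecewise a' b)) - (m (C.piecewise a b') - m (C.piecewise a' b')) =
      ∑ u ∈ C, ∑ j ∈ Cᶜ, m fun i =>
        if i ∈ C then (if i < u then a i else if i = u then a i - a' i else a' i)
        else (if i < j then b i else if i = j then b i - b' i else b' i) := by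
  have h1 := fun v => m.toMultilinearMap.map_piecewise_sub_map_piecewise a a' v C
  simp only [ContinuousMultilinearMap.coe_coe] at h1
  rw [h1, h1, ← Finset.sum_sub_distrib]
  refine Finset.sum_congr rfl fun u _ => ?_
  have h2 := m.toMultilinearMap.map_piecewise_sub_map_piecewise b b'
    (fun i => if i < u then a i else if i = u then a i - a' i else a' i) Cᶜ
  simp only [ContinuousMultilinearMap.coe_coe] at h2
  convert h2 using 2
  · congr 1
    funext i
    by_cases hi : i ∈ C <;> simp [hi]
  · congr 1
    funext i
    by_cases hi : i ∈ C <;> simp [hi]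
  · congr 1
    funext i
    by_cases hi : i ∈ C <;> simp [hi]

variable {T : Type*} [MeasurableSpace T] {ρ : Measure T} [IsProbabilityMeasure ρ]

/-- Antisymmetrisation at the site `s` of the effect of replacing, in the factors of index in `C`,
the variable at this site by an independent copy. -/
theorem integral_piecewise_sub (m : ContinuousMultilinearMap ℂ (fun _ : ι => E) G)
    {M : ℕ} (hM : Fintype.card ι = M) (hM0 : M ≠ 0) (C : Finset ι)
    {U : ι → (ℤ → T) → E} (hU : ∀ i, MemLp (U i) M (siteMeasure ρ)) {s : ℤ} {B : Finset ℤ}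
    (hs : s ∉ B) :
    (2 : ℂ) • ((∫ z, m (C.piecewise (fun i => U i (sel B z)) (fun i => U i (sel ∅ z)))
        ∂siteMeasure (pairMeasure ρ)) -
      ∫ z, m (C.piecewise (fun i => U i (sel (insert s B) z)) (fun i => U i (sel ∅ z)))
        ∂siteMeasure (pairMeasure ρ)) =
    ∑ u ∈ C, ∑ j ∈ Cᶜ, ∫ z, m (fun i =>
        if i ∈ C then (if i < u then U i (sel B z) else if i = u then
          U i (sel B z) - U i (sel (insert s B) z) else U i (sel (insert s B) z))
        else (if i < j then U i (sel ∅ z) else if i = j then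
          U i (sel ∅ z) - U i (sel (insert s ∅) z) else U i (sel (insert s ∅) z)))
        ∂siteMeasure (pairMeasure ρ) := by
  have hsel : ∀ i B, MemLp (fun z => U i (sel B z)) M (siteMeasure (pairMeasure ρ)) :=
    fun i B => (hU i).comp_measurePreserving (measurePreserving_sel ρ B)
  have hintg : ∀ B D, Integrable (fun z => m (C.piecewise (fun i => U i (sel B z))
      (fun i => U i (sel D z)))) (siteMeasure (pairMeasure ρ)) := by
    intro B D
    refine integrable_multilinear m hM hM0 (U := fun i z => C.piecewise (fun i => U i (sel B z))
      (fun i => U i (sel D z)) i) fun i => ?_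
    by_cases hi : i ∈ C
    · simpa [hi] using hsel i B
    · simpa [hi] using hsel i D
  have hswap : ∀ B D, ∫ z, m (C.piecewise (fun i => U i (sel B (swapAt {s} z)))
      (fun i => U i (sel D (swapAt {s} z)))) ∂siteMeasure (pairMeasure ρ) =
      ∫ z, m (C.piecewise (fun i => U i (sel B z)) (fun i => U i (sel D z)))
        ∂siteMeasure (pairMeasure ρ) := fun B D =>
    integral_comp_measurePreserving (measurePreserving_swapAt ρ {s}) (hintg B D).1
  -- The swap at `s` exchanges the selections `B` and `insert s B` and turns `∅` into `{s}`. Adding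
  -- the difference to its swapped form gives a second-order difference, whence the factor `2`.
  have e1 := hswap B ∅
  have e2 := hswap (insert s B) ∅
  simp only [sel_swapAt_of_notMem hs, sel_insert_swapAt hs,
    sel_swapAt_of_notMem (Finset.notMem_empty s)] at e1 e2
  rw [two_smul]
  nth_rw 2 [← e1]
  nth_rw 2 [← e2]
  have hsub : ∀ B B' D, Integrable (fun z =>
      m (C.piecewise (fun i => U i (sel B z)) (fun i => U i (sel D z))) -
        m (C.piecewise (fun i => U i (sel B' z)) (fun i => U i (sel D z))))
      (siteMeasure (pairMeasure ρ)) := fun B B' D => (hintg B D).sub (hintg B' D)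
  have hrw : ∀ a b c d : G, a - b + (c - d) = (a - b) - (d - c) := fun a b c d => by abel
  rw [hrw, ← integral_sub (hintg _ _) (hintg _ _), ← integral_sub (hintg _ _) (hintg _ _),
    ← integral_sub (hsub B (insert s B) ∅) (hsub B (insert s B) (insert s ∅))]
  simp only [multilinear_piecewise_second_difference]
  have hint2 : ∀ u j, Integrable (fun z => m (fun i =>
        if i ∈ C then (if i < u then U i (sel B z) else if i = u then
          U i (sel B z) - U i (sel (insert s B) z) else U i (sel (insert s B) z))
        else (if i < j then U i (sel ∅ z) else if i = j then
          U i (sel ∅ z) - U i (sel (insert s ∅) z) else U i (sel (insert s ∅) z))))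
        (siteMeasure (pairMeasure ρ)) := by
    intro u j
    refine integrable_multilinear m hM hM0 (U := fun i z =>
      if i ∈ C then (if i < u then U i (sel B z) else if i = u then
          U i (sel B z) - U i (sel (insert s B) z) else U i (sel (insert s B) z))
        else (if i < j then U i (sel ∅ z) else if i = j then
          U i (sel ∅ z) - U i (sel (insert s ∅) z) else U i (sel (insert s ∅) z))) fun i => ?_
    split_ifs <;> first | exact hsel _ _ | exact (hsel _ _).sub (hsel _ _)
  rw [integral_finsetSum _ fun u _ => integrable_finsetSum _ fun j _ => hint2 u j]
  exact Finset.sum_congr rfl fun u _ => integral_finsetSum _ fun j _ => hint2 u j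

theorem enorm_le_two_smul (x : G) : ‖x‖ₑ ≤ ‖(2 : ℂ) • x‖ₑ := by
  rw [enorm_le_iff_norm_le, norm_smul]
  have := norm_nonneg x
  simp
  linarith

/-- If the factors in `C` are made independent of the others, the expectation vanishes. -/
theorem integral_decoupled_eq_zero (m : ContinuousMultilinearMap ℂ (fun _ : ι => E) G)
    {M : ℕ} (hM : Fintype.card ι = M) (hM0 : M ≠ 0) {C : Finset ι}
    {U : ι → (ℤ → T) → E} (hU : ∀ i, MemLp (U i) M (siteMeasure ρ))
    {ζ : ℂ} (hζ : ζ ^ C.card ≠ 1) {θ : T → T} (hθ : MeasurePreserving θ ρ ρ)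
    (heig : ∀ i x, U i (fun s => θ (x s)) = ζ • U i x) {F : Finset ℤ}
    (hdep : ∀ i, DependsOn (U i) F) :
    ∫ z, m (C.piecewise (fun i => U i (sel F z)) (fun i => U i (sel ∅ z)))
      ∂siteMeasure (pairMeasure ρ) = 0 := by
  have hintg : AEStronglyMeasurable (fun z => m (C.piecewise (fun i => U i (sel F z))
      (fun i => U i (sel ∅ z)))) (siteMeasure (pairMeasure ρ)) := by
    refine (integrable_multilinear m hM hM0 (U := fun i z => C.piecewise (fun i => U i (sel F z))
      (fun i => U i (sel ∅ z)) i) fun i => ?_).1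
    by_cases hi : i ∈ C
    · simp only [hi, Finset.piecewise_eq_of_mem]
      exact (hU i).comp_measurePreserving (measurePreserving_sel ρ F)
    · simp only [hi, not_false_eq_true, Finset.piecewise_eq_of_notMem]
      exact (hU i).comp_measurePreserving (measurePreserving_sel ρ ∅)
  -- Only second members are rotated. On the sites `F`, the factors in `C` read nothing but second
  -- members and each picks up `ζ`; the other factors read first members only and do not change.
  have hmp : MeasurePreserving (fun (z : ℤ → Fin 2 → T) s a => if a = 1 then θ (z s a) else z s a)
      (siteMeasure (pairMeasure ρ)) (siteMeasure (pairMeasure ρ)) := by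
    refine measurePreserving_infinitePi_map
      (q := fun _ (y : Fin 2 → T) a => if a = 1 then θ (y a) else y a) fun _ =>
      measurePreserving_infinitePi_map (q := fun a (t : T) => if a = 1 then θ t else t) fun a => ?_
    by_cases ha : a = 1
    · simpa [ha] using hθ
    · simp only [ha, if_false]
      exact MeasurePreserving.id ρ
  have h1 := integral_comp_measurePreserving hmp hintg
  have h2 : ∀ z : ℤ → Fin 2 → T, m (C.piecewise
      (fun i => U i (sel F fun s a => if a = 1 then θ (z s a) else z s a))
      (fun i => U i (sel ∅ fun s a => if a = 1 then θ (z s a) else z s a))) =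
      ζ ^ C.card • m (C.piecewise (fun i => U i (sel F z)) (fun i => U i (sel ∅ z))) := by
    intro z
    have h3 : ∀ i, U i (sel F fun s a => if a = 1 then θ (z s a) else z s a) =
        ζ • U i (sel F z) := by
      intro i
      rw [← heig]
      refine hdep i fun s hs => ?_
      have : s ∈ F := hs
      simp [sel, this]
    have h4 : (sel ∅ fun s a => if a = 1 then θ (z s a) else z s a) = sel ∅ z := by
      funext s
      simp [sel]
    rw [h4]
    simp only [h3]
    have h5 := m.toMultilinearMap.map_piecewise_smul (fun _ => ζ)
      (C.piecewise (fun i => U i (sel F z))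
      (fun i => U i (sel ∅ z))) C
    simp only [ContinuousMultilinearMap.coe_coe, Finset.prod_const] at h5
    rw [← h5]
    congr 1
    funext i
    by_cases hi : i ∈ C <;> simp [hi]
  simp only [h2] at h1
  rw [integral_smul] at h1
  by_contra h
  refine (smul_ne_zero (sub_ne_zero.2 hζ) h) ?_
  rw [sub_smul, one_smul, h1, sub_self]

/-- Induction on the number of vertices outside `C`. The state space is quantified inside the
induction because each round replaces `T` by `Fin 2 → T`, on which the coordinatewise `θ` has the
same eigenvalue. A round costs `2 ^ M`: at most a factor `2` for each of the `M` functions. -/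
theorem enorm_integral_le_growthSum (m : ContinuousMultilinearMap ℂ (fun _ : ι => E) G)
    (hm : ∀ x, ‖m x‖ ≤ ∏ i, ‖x i‖) {M : ℕ} (hM : Fintype.card ι = M) {ζ : ℂ}
    (hζ : ∀ k, 0 < k → k < M → ζ ^ k ≠ 1) (k : ℕ) :
    ∀ {T : Type u} [MeasurableSpace T] (ρ : Measure T) [IsProbabilityMeasure ρ] (θ : T → T)
      (_ : MeasurePreserving θ ρ ρ) (C : Finset ι) (_ : C.Nonempty) (_ : Cᶜ.card = k)
      (F : Finset ℤ) (U : ι → (ℤ → T) → E) (_ : ∀ i, MemLp (U i) M (siteMeasure ρ))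
      (_ : ∀ i x, U i (fun s => θ (x s)) = ζ • U i x) (_ : ∀ i, DependsOn (U i) F),
      ‖∫ x, m (fun i => U i x) ∂siteMeasure ρ‖ₑ ≤
        (2 ^ M) ^ k * growthSum k C (fun i A => diffNorm ρ M A (U i)) := by
  induction k with
  | zero =>
    intro T _ ρ _ θ _ C hC hk F U hU _ _
    have hM0 : M ≠ 0 := by
      obtain ⟨i, _⟩ := hC
      rw [← hM]
      exact (Fintype.card_pos_iff.2 ⟨i⟩).ne'
    obtain rfl : C = Finset.univ := by simpa using hk
    rw [growthSum_zero, pow_zero, one_mul]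
    refine (enorm_integral_multilinear_le m hm hM hM0 fun i => (hU i).1).trans (le_of_eq ?_)
    exact Finset.prod_congr rfl fun i _ => (diffNorm_empty (hU i).1).symm
  | succ k ih =>
    intro T _ ρ _ θ hθ C hC hk F U hU heig hdep
    have hM0 : M ≠ 0 := by
      obtain ⟨i, _⟩ := hC
      rw [← hM]
      exact (Fintype.card_pos_iff.2 ⟨i⟩).ne'
    have hCcard : C.card < M := by
      have := Finset.card_compl_add_card C
      omega
    have hp : (1 : ℝ≥0∞) ≤ M := by exact_mod_cast Nat.one_le_iff_ne_zero.2 hM0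
    -- `J B` is the expectation after resampling the factors of `C` at the sites `B`: `J ∅` is the
    -- original one, and at `J F` the factors in `C` are independent of the others.
    set J : Finset ℤ → G := fun B =>
      ∫ z, m (C.piecewise (fun i => U i (sel B z)) (fun i => U i (sel ∅ z)))
        ∂siteMeasure (pairMeasure ρ) with hJ
    have hJ0 : ∫ x, m (fun i => U i x) ∂siteMeasure ρ = J ∅ := by
      rw [hJ, ← integral_comp_measurePreserving (measurePreserving_sel ρ ∅)
        (integrable_multilinear m hM hM0 hU).1]
      simp only [Finset.piecewise_same]
    have hJF : J F = 0 :=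
      integral_decoupled_eq_zero m hM hM0 hU (hζ _ hC.card_pos hCcard) hθ heig hdep
    set c : ℤ → ℝ≥0∞ := fun s => ∑ u ∈ C, ∑ j ∈ Cᶜ, (2 ^ M) ^ (k + 1) * growthSum k (insert j C)
      (fun i A => if u = i ∨ j = i then diffNorm ρ M (insert s A) (U i) else diffNorm ρ M A (U i))
      with hc
    have hstep : ∀ s B, s ∉ B → ‖J B - J (insert s B)‖ₑ ≤ c s := by
      intro s B hs
      refine (enorm_le_two_smul _).trans ?_
      rw [hJ]
      dsimp only
      rw [integral_piecewise_sub m hM hM0 C hU hs]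
      refine (enorm_sum_le _ _).trans (Finset.sum_le_sum fun u hu =>
        (enorm_sum_le _ _).trans (Finset.sum_le_sum fun j hj => ?_))
      have hj' : j ∉ C := Finset.mem_compl.1 hj
      set W : ι → (ℤ → Fin 2 → T) → E := fun i z =>
        if i ∈ C then (if i < u then U i (sel B z) else if i = u then
          U i (sel B z) - U i (sel (insert s B) z) else U i (sel (insert s B) z))
        else (if i < j then U i (sel ∅ z) else if i = j then
          U i (sel ∅ z) - U i (sel (insert s ∅) z) else U i (sel (insert s ∅) z)) with hW
      -- Only the factors `u` and `j` carry a difference at `s`; the others are merely composed with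
      -- a selection, which leaves their difference norms unchanged.
      have hcases : ∀ i, (¬ (u = i ∨ j = i) ∧ ∃ D, W i = U i ∘ sel D) ∨
          ((u = i ∨ j = i) ∧ ∃ D, s ∉ D ∧ W i = U i ∘ sel D - U i ∘ sel (insert s D)) := by
        intro i
        by_cases hi : i ∈ C
        · have hij : j ≠ i := fun h => hj' (h ▸ hi)
          rcases lt_trichotomy i u with h | h | h
          · exact .inl ⟨by simp [hij, h.ne'], B, by funext z; simp [hW, hi, h]⟩
          · exact .inr ⟨.inl h.symm, B, hs, by subst h; funext z; simp [hW, hi]⟩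
          · exact .inl ⟨by simp [hij, h.ne], insert s B, by
              funext z; simp [hW, hi, h.not_gt, h.ne']⟩
        · have hiu : u ≠ i := fun h => hi (h ▸ hu)
          rcases lt_trichotomy i j with h | h | h
          · exact .inl ⟨by simp [hiu, h.ne'], ∅, by funext z; simp [hW, hi, h]⟩
          · exact .inr ⟨.inr h.symm, ∅, by simp, by subst h; funext z; simp [hW, hi]⟩
          · exact .inl ⟨by simp [hiu, h.ne], insert s ∅, by
              funext z; simp [hW, hi, h.not_gt, h.ne']⟩
      have hsel : ∀ i B, MemLp (U i ∘ sel B) M (siteMeasure (pairMeasure ρ)) :=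
        fun i B => (hU i).comp_measurePreserving (measurePreserving_sel ρ B)
      have heig' : ∀ i (D : Finset ℤ) z, (U i ∘ sel D) (fun r a => θ (z r a)) =
          ζ • (U i ∘ sel D) z := fun i D z => heig i (sel D z)
      have hdep' : ∀ i (D : Finset ℤ), DependsOn (U i ∘ sel D) F := fun i D x y h =>
        hdep i fun r hr => by simp [sel, h r hr]
      have hWmem : ∀ i, MemLp (W i) M (siteMeasure (pairMeasure ρ)) := by
        intro i
        rcases hcases i with ⟨_, D, h⟩ | ⟨_, D, _, h⟩ <;> rw [h]
        · exact hsel i D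
        · exact (hsel i _).sub (hsel i _)
      have hWeig : ∀ i z, W i (fun r a => θ (z r a)) = ζ • W i z := by
        intro i z
        rcases hcases i with ⟨_, D, h⟩ | ⟨_, D, _, h⟩ <;> rw [h]
        · exact heig' i D z
        · rw [Pi.sub_apply, Pi.sub_apply, heig', heig', smul_sub]
      have hWdep : ∀ i, DependsOn (W i) F := by
        intro i
        rcases hcases i with ⟨_, D, h⟩ | ⟨_, D, _, h⟩ <;> rw [h]
        · exact hdep' i D
        · intro x y hxy
          rw [Pi.sub_apply, Pi.sub_apply, hdep' i D hxy, hdep' i (insert s D) hxy]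
      have hθ' : MeasurePreserving (fun (y : Fin 2 → T) a => θ (y a)) (pairMeasure ρ)
          (pairMeasure ρ) := measurePreserving_infinitePi_map fun _ => hθ
      have hcard : (insert j C)ᶜ.card = k := by
        have h1 := Finset.card_compl_add_card C
        have h2 := Finset.card_compl_add_card (insert j C)
        rw [Finset.card_insert_of_notMem hj'] at h2
        omega
      refine (ih (pairMeasure ρ) _ hθ' (insert j C) (Finset.insert_nonempty _ _) hcard F W hWmem
        hWeig hWdep).trans ?_
      rw [pow_succ, mul_assoc]
      gcongr
      rw [← hM, ← growthSum_const_mul, hM]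
      refine growthSum_mono fun i A => ?_
      rcases hcases i with ⟨hi, D, h⟩ | ⟨hi, D, hD, h⟩ <;> rw [h]
      · rw [if_neg hi, diffNorm_comp_sel (hU i).1]
        exact le_mul_of_one_le_left' one_le_two
      · rw [if_pos hi]
        exact diffNorm_comp_sel_sub hp (hU i).1 A hD
    have htel : ∀ B : Finset ℤ, ‖J ∅‖ₑ ≤ ‖J B‖ₑ + ∑ s ∈ B, c s := by
      intro B
      induction B using Finset.induction_on with
      | empty => simp
      | insert s B hs ihB =>
        rw [Finset.sum_insert hs, ← add_assoc]
        refine ihB.trans (add_le_add_left ?_ _)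
        have : J B = J (insert s B) + (J B - J (insert s B)) := by abel
        rw [this]
        refine (enorm_add_le _ _).trans ?_
        gcongr
        exact hstep s B hs
    rw [hJ0]
    refine (htel F).trans ?_
    rw [hJF, enorm_zero, zero_add, growthSum_succ, ← ENNReal.tsum_mul_left]
    refine (ENNReal.sum_le_tsum F).trans (le_of_eq (tsum_congr fun s => ?_))
    simp only [hc, Finset.mul_sum]

end Core

/-! ### Interchanging indices in product measures. -/

section Transpose

variable {T : Type*} [MeasurableSpace T]

theorem measurePreserving_infinitePi_swap {ι κ : Type*} (ρ : Measure T) [IsProbabilityMeasure ρ] :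
    MeasurePreserving (fun (z : ι → κ → T) k i => z i k)
      (Measure.infinitePi fun _ : ι => Measure.infinitePi fun _ : κ => ρ)
      (Measure.infinitePi fun _ : κ => Measure.infinitePi fun _ : ι => ρ) := by
  have h1 : MeasurePreserving (MeasurableEquiv.curry ι κ T).symm
      (Measure.infinitePi fun _ : ι => Measure.infinitePi fun _ : κ => ρ)
      (Measure.infinitePi fun _ : ι × κ => ρ) :=
    ⟨MeasurableEquiv.measurable _, Measure.infinitePi_map_curry_symm fun _ _ => ρ⟩
  have h2 : MeasurePreserving (MeasurableEquiv.curry κ ι T)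
      (Measure.infinitePi fun _ : κ × ι => ρ)
      (Measure.infinitePi fun _ : κ => Measure.infinitePi fun _ : ι => ρ) :=
    ⟨MeasurableEquiv.measurable _, Measure.infinitePi_map_curry fun _ _ => ρ⟩
  exact h2.comp ((measurePreserving_infinitePi_comp ρ
    (Prod.swap_injective (α := κ) (β := ι))).comp h1)

/-- Combine two sequences to a sequence of pairs. -/
def zipPair (w : (ℤ → T) × (ℤ → T)) : ℤ → Fin 2 → T := fun s => ![w.1 s, w.2 s]

theorem measurePreserving_zipPair (ρ : Measure T) [IsProbabilityMeasure ρ] :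
    MeasurePreserving zipPair ((siteMeasure ρ).prod (siteMeasure ρ))
      (siteMeasure (pairMeasure ρ)) := by
  have h1 := (measurePreserving_finTwoArrow (siteMeasure ρ)).symm
  rw [← Measure.infinitePi_eq_pi] at h1
  have h2 := (measurePreserving_infinitePi_swap (ι := Fin 2) (κ := ℤ) ρ).comp h1
  convert h2 using 1
  funext w s a
  fin_cases a <;> rfl

end Transpose

/-! ### Approximation by functionals of finitely many sites. -/

section Averaging

variable {T E : Type*} [MeasurableSpace T] [NormedAddCommGroup E]

/-- Jensen's inequality in the inner variable, then Tonelli. -/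
theorem eLpNorm_integral_prod_le {α β : Type*} [NormedSpace ℝ E] [MeasurableSpace α]
    [MeasurableSpace β] {μ : Measure α} {ν : Measure β} [SFinite μ] [IsProbabilityMeasure ν]
    {p : ℝ≥0∞} (hp1 : 1 ≤ p) (hp : p ≠ ∞) {f : α × β → E}
    (hf : AEStronglyMeasurable f (μ.prod ν)) :
    eLpNorm (fun x => ∫ y, f (x, y) ∂ν) p μ ≤ eLpNorm f p (μ.prod ν) := by
  have hp0 : p ≠ 0 := (zero_lt_one.trans_le hp1).ne'
  have hpr : 0 < p.toReal := ENNReal.toReal_pos hp0 hp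
  rw [eLpNorm_eq_lintegral_rpow_enorm_toReal hp0 hp, eLpNorm_eq_lintegral_rpow_enorm_toReal hp0 hp]
  refine ENNReal.rpow_le_rpow ?_ (by positivity)
  rw [lintegral_prod _ (hf.enorm.pow_const _)]
  refine lintegral_mono_ae ?_
  filter_upwards [hf.prodMk_left] with x hx
  have h1 : ‖∫ y, f (x, y) ∂ν‖ₑ ≤ eLpNorm (fun y => f (x, y)) p ν :=
    (enorm_integral_le_lintegral_enorm _).trans
      (eLpNorm_one_eq_lintegral_enorm.symm.le.trans (eLpNorm_le_eLpNorm_of_exponent_le hp1 hx))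
  rw [eLpNorm_eq_lintegral_rpow_enorm_toReal hp0 hp] at h1
  calc ‖∫ y, f (x, y) ∂ν‖ₑ ^ p.toReal
      ≤ ((∫⁻ y, ‖f (x, y)‖ₑ ^ p.toReal ∂ν) ^ (1 / p.toReal)) ^ p.toReal :=
        ENNReal.rpow_le_rpow h1 hpr.le
    _ = _ := by rw [← ENNReal.rpow_mul, one_div_mul_cancel hpr.ne', ENNReal.rpow_one]

variable [NormedSpace ℝ E]

/-- The conditional expectation of `U` given the sites in `F`. -/
def avg (ρ : Measure T) (F : Finset ℤ) (U : (ℤ → T) → E) (x : ℤ → T) : E :=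
  ∫ y, U (sel F (zipPair (y, x))) ∂siteMeasure ρ

theorem dependsOn_avg (ρ : Measure T) (F : Finset ℤ) (U : (ℤ → T) → E) :
    DependsOn (avg ρ F U) F := by
  intro x x' h
  refine integral_congr_ae (Filter.Eventually.of_forall fun y => ?_)
  dsimp only
  congr 1
  funext s
  by_cases hs : s ∈ F
  · simp [sel, zipPair, hs, h s hs]
  · simp [sel, zipPair, hs]

variable {ρ : Measure T} [IsProbabilityMeasure ρ] {p : ℝ≥0∞} {U V : (ℤ → T) → E}

theorem measurePreserving_mix (ρ : Measure T) [IsProbabilityMeasure ρ] (F : Finset ℤ) :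
    MeasurePreserving (fun w : (ℤ → T) × (ℤ → T) => sel F (zipPair (w.2, w.1)))
      ((siteMeasure ρ).prod (siteMeasure ρ)) (siteMeasure ρ) :=
  (measurePreserving_sel ρ F).comp
    ((measurePreserving_zipPair ρ).comp Measure.measurePreserving_swap)

theorem avg_of_dependsOn [CompleteSpace E] {F : Finset ℤ} (hU : DependsOn U F) : avg ρ F U = U := by
  funext x
  have : ∀ y, U (sel F (zipPair (y, x))) = U x := by
    intro y
    refine hU fun s hs => ?_
    have : s ∈ F := hs
    simp [sel, zipPair, this]
  simp [avg, this]

theorem aestronglyMeasurable_avg (hU : AEStronglyMeasurable U (siteMeasure ρ)) (F : Finset ℤ) :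
    AEStronglyMeasurable (avg ρ F U) (siteMeasure ρ) :=
  (hU.comp_measurePreserving (measurePreserving_mix ρ F)).integral_prod_right'

theorem eLpNorm_avg_le (hp1 : 1 ≤ p) (hp : p ≠ ∞) (hU : AEStronglyMeasurable U (siteMeasure ρ))
    (F : Finset ℤ) : eLpNorm (avg ρ F U) p (siteMeasure ρ) ≤ eLpNorm U p (siteMeasure ρ) := by
  have h := measurePreserving_mix ρ F
  refine (eLpNorm_integral_prod_le hp1 hp (hU.comp_measurePreserving h)).trans (le_of_eq ?_)
  exact eLpNorm_comp_measurePreserving hU h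

theorem memLp_avg (hp1 : 1 ≤ p) (hp : p ≠ ∞) (hU : MemLp U p (siteMeasure ρ)) (F : Finset ℤ) :
    MemLp (avg ρ F U) p (siteMeasure ρ) :=
  ⟨aestronglyMeasurable_avg hU.1 F, (eLpNorm_avg_le hp1 hp hU.1 F).trans_lt hU.2⟩

theorem avg_sub_ae (hp1 : 1 ≤ p) (hU : MemLp U p (siteMeasure ρ)) (hV : MemLp V p (siteMeasure ρ))
    (F : Finset ℤ) : avg ρ F (U - V) =ᵐ[siteMeasure ρ] avg ρ F U - avg ρ F V := by
  have h := measurePreserving_mix ρ F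
  have hU1 := ((hU.comp_measurePreserving h).integrable hp1).prod_right_ae
  have hV1 := ((hV.comp_measurePreserving h).integrable hp1).prod_right_ae
  filter_upwards [hU1, hV1] with x h1 h2
  exact integral_sub h1 h2

/-- Averaging over the sites outside `F` commutes almost everywhere with iterated differences and is
a contraction of `L^p`. -/
theorem diffNorm_avg_le (hp1 : 1 ≤ p) (hp : p ≠ ∞)
    (hU : MemLp U p (siteMeasure ρ))
    (A F : Finset ℤ) : diffNorm ρ p A (avg ρ F U) ≤ diffNorm ρ p A U := by
  rw [diffNorm, diffNorm]
  refine le_trans (le_of_eq (eLpNorm_congr_ae ?_))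
    (eLpNorm_avg_le hp1 hp (aestronglyMeasurable_diff hU.1 A) F)
  have h1 := ae_all_iff.2 fun B : Finset ℤ =>
    (((hU.comp_measurePreserving (measurePreserving_sel ρ B)).comp_measurePreserving
      (measurePreserving_mix (pairMeasure ρ) F)).integrable hp1).prod_right_ae
  have h2 := ae_all_iff.2 fun B : Finset ℤ => (measurePreserving_sel ρ B).quasiMeasurePreserving.ae
    ((hU.comp_measurePreserving (measurePreserving_mix ρ F)).integrable hp1).prod_right_ae
  filter_upwards [h1, h2] with z hz hz2
  simp only [diff, avg, ← Int.cast_smul_eq_zsmul ℝ]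
  have hz' : ∀ B : Finset ℤ, Integrable (fun y => (((-1 : ℤ) ^ B.card : ℤ) : ℝ) •
      U (sel B (sel F (zipPair (y, z))))) (siteMeasure (pairMeasure ρ)) := fun B => (hz B).smul _
  rw [integral_finsetSum _ fun B _ => hz' B]
  refine Finset.sum_congr rfl fun B _ => ?_
  rw [integral_smul]
  congr 1
  refine (integral_comp_measurePreserving (measurePreserving_sel ρ B) (hz2 B).1).symm.trans ?_
  refine integral_congr_ae (Filter.Eventually.of_forall fun w => ?_)
  simp only [Function.comp_apply]
  congr 1
  funext s
  by_cases hs : s ∈ F <;> simp [sel, zipPair, hs]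

/-- Cylinders form a ring generating the product σ-algebra, so they approximate measurable sets in
measure; the density of simple functions does the rest. -/
theorem exists_dependsOn_eLpNorm_sub_le (hp : p ≠ ∞) (hU : MemLp U p (siteMeasure ρ))
    {δ : ℝ≥0∞} (hδ : δ ≠ 0) : ∃ V : (ℤ → T) → E, eLpNorm (U - V) p (siteMeasure ρ) ≤ δ ∧
      AEStronglyMeasurable V (siteMeasure ρ) ∧ ∃ F : Finset ℤ, DependsOn V F := by
  refine MemLp.induction_dense hp (fun V => AEStronglyMeasurable V (siteMeasure ρ) ∧
    ∃ F : Finset ℤ, DependsOn V F) ?_ ?_ (fun f hf => hf.1) hU hδ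
  · intro c s hs _ ε hε
    obtain ⟨η, hη, h⟩ := exists_eLpNorm_indicator_le (μ := siteMeasure ρ) hp c hε
    obtain ⟨t, ht, hts⟩ := exists_measure_symmDiff_lt_of_generateFrom_isSetRing
      (μ := siteMeasure ρ) (isSetRing_measurableCylinders (α := fun _ : ℤ => T))
      ⟨{Set.univ}, Set.countable_singleton _, by
        simpa using univ_mem_measurableCylinders (fun _ : ℤ => T), by simp⟩
      generateFrom_measurableCylinders.symm hs (ε := η) (by exact_mod_cast hη)
    obtain ⟨F, S, hS, rfl⟩ := (mem_measurableCylinders t).1 ht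
    refine ⟨(cylinder F S).indicator fun _ => c, ?_, ?_, F, ?_⟩
    · rw [eLpNorm_indicator_sub_indicator]
      exact h _ hts.le
    · exact aestronglyMeasurable_const.indicator (MeasurableSet.cylinder F hS)
    · intro x y hxy
      have : F.restrict x = F.restrict y := funext fun i => hxy i i.2
      have hiff : x ∈ cylinder F S ↔ y ∈ cylinder F S := by
        rw [mem_cylinder F S x, mem_cylinder F S y, this]
      by_cases hx : x ∈ cylinder F S
      · rw [Set.indicator_of_mem hx, Set.indicator_of_mem (hiff.1 hx)]
      · rw [Set.indicator_of_notMem hx, Set.indicator_of_notMem fun h => hx (hiff.2 h)]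
  · rintro f g ⟨hf, F, hF⟩ ⟨hg, F', hF'⟩
    refine ⟨hf.add hg, F ∪ F', fun x y hxy => ?_⟩
    rw [Pi.add_apply, Pi.add_apply, hF fun i hi => hxy i (by simp at hi ⊢; exact .inl hi),
      hF' fun i hi => hxy i (by simp at hi ⊢; exact .inr hi)]

/-- `avg` fixes an approximant that depends on `F` only, and it contracts the remainder. -/
theorem exists_eLpNorm_sub_avg_le [CompleteSpace E] (hp1 : 1 ≤ p) (hp : p ≠ ∞)
    (hU : MemLp U p (siteMeasure ρ))
    {δ : ℝ≥0∞} (hδ : δ ≠ 0) : ∃ F₀ : Finset ℤ, ∀ F, F₀ ⊆ F →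
      eLpNorm (U - avg ρ F U) p (siteMeasure ρ) ≤ δ := by
  -- The minimum with `1` keeps `U - V` in `L^p` even for `δ = ∞`.
  obtain ⟨V, hV, hVm, F₀, hF₀⟩ := exists_dependsOn_eLpNorm_sub_le hp hU
    (δ := min 1 (δ / 2)) (by simp [hδ])
  have hUV : MemLp (U - V) p (siteMeasure ρ) :=
    ⟨hU.1.sub hVm, hV.trans_lt ((min_le_left _ _).trans_lt ENNReal.one_lt_top)⟩
  have hVmem : MemLp V p (siteMeasure ρ) := by
    have := hU.sub hUV
    rwa [sub_sub_cancel] at this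
  refine ⟨F₀, fun F hF => ?_⟩
  have hVF : DependsOn V F := fun x y h => hF₀ fun i hi => h i (hF hi)
  have h1 : U - avg ρ F U =ᵐ[siteMeasure ρ] (U - V) - avg ρ F (U - V) := by
    filter_upwards [avg_sub_ae hp1 hU hVmem F] with x hx
    simp only [Pi.sub_apply] at hx ⊢
    rw [hx, avg_of_dependsOn hVF]
    abel
  rw [eLpNorm_congr_ae h1]
  calc _ ≤ eLpNorm (U - V) p (siteMeasure ρ) + eLpNorm (avg ρ F (U - V)) p (siteMeasure ρ) :=
        eLpNorm_sub_le hUV.1 (aestronglyMeasurable_avg hUV.1 F) hp1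
    _ ≤ δ / 2 + δ / 2 := by
        refine add_le_add (hV.trans (min_le_right _ _)) ?_
        exact (eLpNorm_avg_le hp1 hp hUV.1 F).trans (hV.trans (min_le_right _ _))
    _ = δ := ENNReal.add_halves δ

end Averaging

/-! ### Continuity of multilinear expectations in `L^M`. -/

section Approximation

variable {α ι E G : Type*} [MeasurableSpace α] {μ : Measure α} [Fintype ι] [LinearOrder ι]
  [NormedAddCommGroup E] [NormedSpace ℂ E] [SecondCountableTopology E]
  [NormedAddCommGroup G] [NormedSpace ℂ G] [CompleteSpace G]

theorem enorm_integral_multilinear_sub_le (m : ContinuousMultilinearMap ℂ (fun _ : ι => E) G)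
    (hm : ∀ x, ‖m x‖ ≤ ∏ i, ‖x i‖) {M : ℕ} (hM : Fintype.card ι = M) (hM0 : M ≠ 0)
    {U V : ι → α → E} (hU : ∀ i, MemLp (U i) M μ) (hV : ∀ i, MemLp (V i) M μ) {δ K : ℝ≥0∞}
    (hδ : ∀ i, eLpNorm (U i - V i) M μ ≤ δ) (hKU : ∀ i, eLpNorm (U i) M μ ≤ K)
    (hKV : ∀ i, eLpNorm (V i) M μ ≤ K) :
    ‖(∫ x, m (fun i => U i x) ∂μ) - ∫ x, m (fun i => V i x) ∂μ‖ₑ ≤ M * (δ * K ^ (M - 1)) := by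
  let W : ι → ι → α → E := fun i j =>
    if j < i then U j else if i = j then U j - V j else V j
  have hW : ∀ i j, MemLp (W i j) M μ := by
    intro i j
    simp only [W]
    split_ifs
    exacts [hU j, (hU j).sub (hV j), hV j]
  have hid : ∀ x, m (fun i => U i x) - m (fun i => V i x) = ∑ i, m fun j => W i j x := by
    intro x
    have := m.toMultilinearMap.map_sub_map_piecewise (fun i => U i x) (fun i => V i x) Finset.univ
    simp only [Finset.piecewise_univ, ContinuousMultilinearMap.coe_coe, Finset.mem_univ,
      forall_const] at this
    rw [this]
    refine Finset.sum_congr rfl fun i _ => ?_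
    congr 1
    funext j
    simp only [W]
    split_ifs <;> rfl
  rw [← integral_sub (integrable_multilinear m hM hM0 hU) (integrable_multilinear m hM hM0 hV)]
  simp only [hid]
  rw [integral_finsetSum _ fun i _ => integrable_multilinear m hM hM0 (hW i)]
  refine (enorm_sum_le _ _).trans ?_
  rw [← hM, ← Finset.card_univ, ← nsmul_eq_mul, ← Finset.sum_const]
  refine Finset.sum_le_sum fun i _ =>
    (enorm_integral_multilinear_le m hm hM hM0 fun j => (hW i j).1).trans ?_
  rw [← Finset.mul_prod_erase _ _ (Finset.mem_univ i)]
  refine mul_le_mul' (by simpa [W] using hδ i) ?_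
  rw [← Finset.card_erase_of_mem (Finset.mem_univ i)]
  refine Finset.prod_le_pow_card _ _ _ fun j hj => ?_
  have hij : i ≠ j := (Finset.ne_of_mem_erase hj).symm
  simp only [W, hij, if_false]
  split_ifs
  exacts [hKU j, hKV j]

theorem enorm_integral_multilinear_le_of_approx
    (m : ContinuousMultilinearMap ℂ (fun _ : ι => E) G)
    (hm : ∀ x, ‖m x‖ ≤ ∏ i, ‖x i‖) {M : ℕ} (hM : Fintype.card ι = M) (hM0 : M ≠ 0)
    {U : ι → α → E} (hU : ∀ i, MemLp (U i) M μ) {b : ℝ≥0∞}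
    (h : ∀ δ : ℝ≥0∞, δ ≠ 0 → ∃ V : ι → α → E, (∀ i, MemLp (V i) M μ) ∧
      (∀ i, eLpNorm (U i - V i) M μ ≤ δ) ∧ ‖∫ x, m (fun i => V i x) ∂μ‖ₑ ≤ b) :
    ‖∫ x, m (fun i => U i x) ∂μ‖ₑ ≤ b := by
  have hp : (1 : ℝ≥0∞) ≤ M := by exact_mod_cast Nat.one_le_iff_ne_zero.2 hM0
  -- The `+ 1` leaves room for approximants at distance at most `1`.
  set K : ℝ≥0∞ := ∑ i, eLpNorm (U i) M μ + 1 with hK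
  have hKtop : K ≠ ∞ := by simp [hK, ENNReal.sum_eq_top, (hU _).2.ne]
  have hUK : ∀ i, eLpNorm (U i) M μ + 1 ≤ K := fun i => by
    rw [hK]
    gcongr
    exact Finset.single_le_sum (f := fun i => eLpNorm (U i) M μ) (fun _ _ => zero_le)
      (Finset.mem_univ i)
  refine ENNReal.le_of_forall_pos_le_add fun ε hε _ => ?_
  have hc : (M : ℝ≥0∞) * K ^ (M - 1) ≠ ∞ :=
    ENNReal.mul_ne_top (by simp) (ENNReal.pow_ne_top hKtop)
  obtain ⟨V, hV, hUV, hb⟩ := h (min 1 (ε / (M * K ^ (M - 1)))) (by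
    refine (lt_min one_pos (ENNReal.div_pos ?_ hc)).ne'
    simpa using hε.ne')
  have hVK : ∀ i, eLpNorm (V i) M μ ≤ K := by
    intro i
    have : V i = U i - (U i - V i) := by abel
    rw [this]
    refine (eLpNorm_sub_le (hU i).1 ((hU i).sub (hV i)).1 hp).trans (le_trans ?_ (hUK i))
    gcongr
    exact (hUV i).trans (min_le_left _ _)
  have h1 := enorm_integral_multilinear_sub_le m hm hM hM0 hU hV hUV
    (fun i => le_self_add.trans (hUK i)) hVK
  have h2 : ∫ x, m (fun i => U i x) ∂μ = (∫ x, m (fun i => V i x) ∂μ) +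
      ((∫ x, m (fun i => U i x) ∂μ) - ∫ x, m (fun i => V i x) ∂μ) := by abel
  rw [h2]
  refine (enorm_add_le _ _).trans (add_le_add hb (h1.trans ?_))
  calc (M : ℝ≥0∞) * (min 1 (ε / (M * K ^ (M - 1))) * K ^ (M - 1))
      = (min 1 (ε / (M * K ^ (M - 1)))) * (M * K ^ (M - 1)) := by ring
    _ ≤ (ε / (M * K ^ (M - 1))) * (M * K ^ (M - 1)) := by gcongr; exact min_le_right _ _
    _ ≤ ε := by rw [mul_comm]; exact ENNReal.mul_div_le

end Approximation

/-! ### Fourier combinations of independent copies. -/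

section Copies

variable {S : Type*} [MeasurableSpace S] {E : Type*} [NormedAddCommGroup E] [NormedSpace ℂ E]

/-- The discrete Fourier combination `∑_a ω^a y^{(a)}` of the functions `y^{(a)}` obtained from `y`
by evaluation at `M` independent copies. -/
def copies {M : ℕ} (ω : ℂ) (y : (ℤ → S) → E) (x : ℤ → Fin M → S) : E :=
  ∑ a : Fin M, ω ^ (a : ℕ) • y (fun s => x s a)

/-- The law of `M` independent elements of law `ρ`. -/
abbrev copyMeasure (M : ℕ) (ρ : Measure S) : Measure (Fin M → S) := Measure.infinitePi fun _ => ρ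

variable {ρ : Measure S} [IsProbabilityMeasure ρ] {M : ℕ} {ω : ℂ} {p : ℝ≥0∞}

theorem measurePreserving_copy (ρ : Measure S) [IsProbabilityMeasure ρ] (a : Fin M) :
    MeasurePreserving (fun (x : ℤ → Fin M → S) s => x s a) (siteMeasure (copyMeasure M ρ))
      (siteMeasure ρ) :=
  measurePreserving_infinitePi_map fun _ => measurePreserving_eval_infinitePi _ _

theorem copies_eq_sum (ω : ℂ) (y : (ℤ → S) → E) :
    copies (M := M) ω y = ∑ a : Fin M, ω ^ (a : ℕ) • (y ∘ fun x s => x s a) := by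
  funext x
  simp [copies]

theorem memLp_copies {y : (ℤ → S) → E} (hy : MemLp y p (siteMeasure ρ)) :
    MemLp (copies (M := M) ω y) p (siteMeasure (copyMeasure M ρ)) := by
  rw [copies_eq_sum]
  exact memLp_finsetSum' _ fun a _ =>
    (hy.comp_measurePreserving (measurePreserving_copy ρ a)).const_smul _

theorem eLpNorm_copies_le (hp : 1 ≤ p) (hω : ‖ω‖ = 1) {y : (ℤ → S) → E}
    (hy : AEStronglyMeasurable y (siteMeasure ρ)) :
    eLpNorm (copies (M := M) ω y) p (siteMeasure (copyMeasure M ρ)) ≤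
      M * eLpNorm y p (siteMeasure ρ) := by
  rw [copies_eq_sum]
  refine (eLpNorm_sum_le (fun a _ =>
    (hy.comp_measurePreserving (measurePreserving_copy ρ a)).const_smul _) hp).trans ?_
  refine le_trans (Finset.sum_le_sum (g := fun _ => eLpNorm y p (siteMeasure ρ)) fun a _ => ?_)
    (by simp)
  rw [eLpNorm_const_smul, eLpNorm_comp_measurePreserving hy (measurePreserving_copy ρ a)]
  simp [← ofReal_norm, hω]

theorem copies_sub (y y' : (ℤ → S) → E) :
    copies (M := M) ω y - copies ω y' = copies ω (y - y') := by
  funext x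
  simp [copies, smul_sub, Finset.sum_sub_distrib]

theorem diffNorm_copies_le (hp : 1 ≤ p) (hω : ‖ω‖ = 1) {y : (ℤ → S) → E}
    (hy : AEStronglyMeasurable y (siteMeasure ρ)) (A : Finset ℤ) :
    diffNorm (copyMeasure M ρ) p A (copies (M := M) ω y) ≤ M * diffNorm ρ p A y := by
  have hmp : ∀ a : Fin M, MeasurePreserving (fun (z : ℤ → Fin 2 → Fin M → S) s b => z s b a)
      (siteMeasure (pairMeasure (copyMeasure M ρ))) (siteMeasure (pairMeasure ρ)) := fun a =>
    measurePreserving_infinitePi_map (q := fun _ (w : Fin 2 → Fin M → S) b => w b a) fun _ =>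
      measurePreserving_infinitePi_map (q := fun _ (v : Fin M → S) => v a) fun _ =>
        measurePreserving_eval_infinitePi _ _
  have hdiff : diff A (copies (M := M) ω y) =
      ∑ a : Fin M, ω ^ (a : ℕ) • (diff A y ∘ fun z s b => z s b a) := by
    funext z
    simp only [diff, copies, Finset.smul_sum, Finset.sum_apply, Pi.smul_apply, Function.comp_apply]
    rw [Finset.sum_comm]
    refine Finset.sum_congr rfl fun a _ => Finset.sum_congr rfl fun B _ => ?_
    rw [smul_comm]
    rfl
  have hd := aestronglyMeasurable_diff hy A
  rw [diffNorm, diffNorm, hdiff]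
  refine (eLpNorm_sum_le (fun a _ => (hd.comp_measurePreserving (hmp a)).const_smul _) hp).trans ?_
  refine le_trans (Finset.sum_le_sum
    (g := fun _ => eLpNorm (diff A y) p (siteMeasure (pairMeasure ρ))) fun a _ => ?_) (by simp)
  rw [eLpNorm_const_smul, eLpNorm_comp_measurePreserving hd (hmp a)]
  simp [← ofReal_norm, hω]

theorem dependsOn_copies {F : Finset ℤ} {y : (ℤ → S) → E} (hy : DependsOn y F) :
    DependsOn (copies (M := M) ω y) F := by
  intro x x' h
  refine Finset.sum_congr rfl fun a _ => ?_
  rw [hy fun s hs => congrFun (h s hs) a]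

/-- The index shift `a ↦ a + 1` makes the combination an eigenvector of the rotation, wrapping
around consistently because `ω ^ (m + 1) = 1`. No power `0 < j < m + 1` of the eigenvalue is `1`,
which is what decoupling needs. -/
theorem copies_rotate {m : ℕ} (hω : IsPrimitiveRoot ω (m + 1)) (y : (ℤ → S) → E)
    (x : ℤ → Fin (m + 1) → S) :
    copies ω y (fun s a => x s (a + 1)) = ω⁻¹ • copies ω y x := by
  have hω0 : ω ≠ 0 := hω.ne_zero (by simp)
  rw [eq_inv_smul_iff₀ hω0, copies, Finset.smul_sum, copies,
    ← Equiv.sum_comp (Equiv.addRight (1 : Fin (m + 1))) fun a => ω ^ (a : ℕ) • y fun s => x s a]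
  refine Finset.sum_congr rfl fun a _ => ?_
  rw [Equiv.coe_addRight, smul_smul, ← pow_succ', Fin.val_add_eq_ite]
  congr 1
  -- In `Fin 1` the element `1` has value `0`, so this case is separate.
  rcases Nat.eq_zero_or_pos m with rfl | hm
  · have : ω = 1 := by simpa using hω
    simp [this]
  · have h1 : ((1 : Fin (m + 1)) : ℕ) = 1 := by
      rw [Fin.val_one']
      exact Nat.mod_eq_of_lt (by omega)
    rw [h1]
    split_ifs with h
    · have : (a : ℕ) + 1 = m + 1 := le_antisymm a.2 h
      rw [this, hω.pow_eq_one, Nat.sub_self, pow_zero]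
    · rfl

theorem norm_eq_one_of_isPrimitiveRoot {m : ℕ} (hω : IsPrimitiveRoot ω (m + 1)) : ‖ω‖ = 1 :=
  hω.norm'_eq_one (by simp)

variable {ι G : Type*} [Fintype ι] [LinearOrder ι] [SecondCountableTopology E] [CompleteSpace E]
  [NormedAddCommGroup G] [NormedSpace ℂ G] [CompleteSpace G]

/-- The tree bound is applied to averages over a finite set of sites. Averaging does not increase
difference norms, so the bound is uniform in that set and passes to the limit; passing to copies
costs a factor `k + 1` per vertex. -/
theorem enorm_integral_copies_le (m : ContinuousMultilinearMap ℂ (fun _ : ι => E) G)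
    (hm : ∀ x, ‖m x‖ ≤ ∏ i, ‖x i‖) {k : ℕ} (hk : Fintype.card ι = k + 1)
    (hω : IsPrimitiveRoot ω (k + 1)) (i₀ : ι)
    {y : ι → (ℤ → S) → E} (hy : ∀ i, MemLp (y i) (k + 1 : ℕ) (siteMeasure ρ)) :
    ‖∫ x, m (fun i => copies (M := k + 1) ω (y i) x) ∂siteMeasure (copyMeasure (k + 1) ρ)‖ₑ ≤
      (2 ^ (k + 1)) ^ k * ((k + 1 : ℕ) ^ (k + 1) *
        growthSum k {i₀} (fun i A => diffNorm ρ (k + 1 : ℕ) A (y i))) := by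
  have hω1 := norm_eq_one_of_isPrimitiveRoot hω
  have hp1 : (1 : ℝ≥0∞) ≤ (k + 1 : ℕ) := by exact_mod_cast Nat.le_add_left 1 k
  have hp : ((k + 1 : ℕ) : ℝ≥0∞) ≠ ∞ := ENNReal.natCast_ne_top _
  refine enorm_integral_multilinear_le_of_approx m hm hk (Nat.succ_ne_zero k)
    (fun i => memLp_copies (hy i)) fun δ hδ => ?_
  have hδ' : δ / (k + 1 : ℕ) ≠ 0 := (ENNReal.div_pos hδ hp).ne'
  choose F₀ hF₀ using fun i => exists_eLpNorm_sub_avg_le hp1 hp (hy i) hδ'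
  set F := Finset.univ.biUnion F₀ with hF
  have hav : ∀ i, MemLp (avg ρ F (y i)) (k + 1 : ℕ) (siteMeasure ρ) := fun i =>
    memLp_avg hp1 hp (hy i) F
  refine ⟨fun i => copies ω (avg ρ F (y i)), fun i => memLp_copies (hav i), fun i => ?_, ?_⟩
  · rw [copies_sub]
    refine (eLpNorm_copies_le hp1 hω1 ((hy i).sub (hav i)).1).trans ?_
    refine (mul_le_mul_right (hF₀ i F ?_) _).trans ENNReal.mul_div_le
    exact Finset.subset_biUnion_of_mem F₀ (Finset.mem_univ i)
  · have hθ : MeasurePreserving (fun (t : Fin (k + 1) → S) a => t (a + 1)) (copyMeasure (k + 1) ρ)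
        (copyMeasure (k + 1) ρ) := measurePreserving_infinitePi_comp ρ (add_left_injective 1)
    refine (enorm_integral_le_growthSum m hm hk (ζ := ω⁻¹) (fun j hj hjk h => ?_) k
      (copyMeasure (k + 1) ρ) _ hθ {i₀} (Finset.singleton_nonempty _)
      (by rw [Finset.card_compl, hk, Finset.card_singleton]; simp) F _
      (fun i => memLp_copies (hav i)) (fun i x => copies_rotate hω _ x)
      fun i => dependsOn_copies (dependsOn_avg ρ F _)).trans ?_
    · rw [inv_pow, inv_eq_one] at h
      exact (Nat.le_of_dvd hj (hω.dvd_of_pow_eq_one j h)).not_gt hjk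
    · gcongr
      have hc := growthSum_const_mul k {i₀} (fun i A => diffNorm ρ (k + 1 : ℕ) A (y i))
        ((k + 1 : ℕ) : ℝ≥0∞)
      rw [hk] at hc
      rw [← hc]
      refine growthSum_mono fun i A => (diffNorm_copies_le hp1 hω1 (hav i).1 A).trans ?_
      gcongr
      exact diffNorm_avg_le hp1 hp (hy i) A F

/-- The expectation of a product of discrete Fourier combinations of independent copies is, up to
a factor, a joint cumulant. -/
theorem integral_prod_copies {k : ℕ} (hk : Fintype.card ι = k + 1)
    (hω : IsPrimitiveRoot ω (k + 1))
    {f : ι → (ℤ → S) → ℂ} (hf : ∀ i, MemLp (f i) (k + 1 : ℕ) (siteMeasure ρ)) :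
    ∫ x, ∏ i, copies (M := k + 1) ω (f i) x ∂siteMeasure (copyMeasure (k + 1) ρ) =
      (k + 1 : ℕ) * ∑ v : Finpartition (Finset.univ : Finset ι),
        ((-1) ^ (v.parts.card - 1) * ((v.parts.card - 1)! : ℂ)) *
          ∏ B ∈ v.parts, ∫ x, ∏ i ∈ B, f i x ∂siteMeasure ρ := by
  have hne : Nonempty ι := Fintype.card_pos_iff.1 (by omega)
  rw [← sum_copies_eq_sum_finpartition hk hω (fun B => ∫ x, ∏ i ∈ B, f i x ∂siteMeasure ρ)
    (by simp)]
  have h1 : ∀ x : ℤ → Fin (k + 1) → S, ∏ i, copies (M := k + 1) ω (f i) x =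
      ∑ c : ι → Fin (k + 1), (∏ i, ω ^ (c i : ℕ)) * ∏ i, f i (fun s => x s (c i)) := by
    intro x
    simp only [copies, smul_eq_mul, Finset.prod_univ_sum, Fintype.piFinset_univ,
      Finset.prod_mul_distrib]
  have hintg : ∀ c : ι → Fin (k + 1), Integrable (fun x : ℤ → Fin (k + 1) → S =>
      ∏ i, f i (fun s => x s (c i))) (siteMeasure (copyMeasure (k + 1) ρ)) := by
    intro c
    have := integrable_multilinear (ContinuousMultilinearMap.mkPiAlgebra ℂ ι ℂ) hk
      (Nat.succ_ne_zero k) (U := fun i (x : ℤ → Fin (k + 1) → S) =>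
        f i (fun s => x s (c i))) fun i =>
      (hf i).comp_measurePreserving (measurePreserving_copy ρ (c i))
    simpa using this
  simp only [h1]
  rw [integral_finsetSum _ fun c _ => (hintg c).const_mul _]
  refine Finset.sum_congr rfl fun c _ => ?_
  rw [integral_const_mul]
  congr 1
  have h2 : ∀ x : ℤ → Fin (k + 1) → S, ∏ i, f i (fun s => x s (c i)) =
      ∏ a, ∏ i with c i = a, f i (fun s => x s a) := by
    intro x
    rw [← Finset.prod_fiberwise Finset.univ c]
    refine Finset.prod_congr rfl fun a _ => Finset.prod_congr rfl fun i hi => ?_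
    rw [(Finset.mem_filter.1 hi).2]
  simp only [h2]
  have hmeas : AEStronglyMeasurable (fun w : Fin (k + 1) → ℤ → S =>
      ∏ a, ∏ i with c i = a, f i (w a)) (Measure.infinitePi fun _ => siteMeasure ρ) :=
    Finset.aestronglyMeasurable_fun_prod _ fun a _ => Finset.aestronglyMeasurable_fun_prod _
      fun i _ => (hf i).1.comp_measurePreserving (measurePreserving_eval_infinitePi _ a)
  -- After transposition the copies are independent whole sequences, so the expectation factors over
  -- the labels.
  rw [integral_comp_measurePreserving
    (measurePreserving_infinitePi_swap (ι := ℤ) (κ := Fin (k + 1)) ρ) hmeas,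
    Measure.infinitePi_eq_pi]
  exact integral_fintype_prod_eq_prod (𝕜 := ℂ) fun a (x : ℤ → S) => ∏ i with c i = a, f i x

end Copies

/-! ### Tensor products in finitely many coordinates. -/

section TensorMap

variable {ι β : Type*} [Fintype ι] [DecidableEq ι] [Fintype β]

/-- The tensor product of vectors in coordinates. -/
def tensorMap (ι β : Type*) [Fintype ι] [DecidableEq ι] [Fintype β] : ContinuousMultilinearMap ℂ
    (fun _ : ι => EuclideanSpace ℂ β) (EuclideanSpace ℂ (ι → β)) :=
  (PiLp.continuousLinearEquiv 2 ℂ fun _ : ι → β => ℂ).symm.toContinuousLinearMap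
    |>.compContinuousMultilinearMap
    (ContinuousMultilinearMap.pi fun κ : ι → β =>
      (ContinuousMultilinearMap.mkPiAlgebra ℂ ι ℂ).compContinuousLinearMap
        fun i => EuclideanSpace.proj (κ i))

theorem tensorMap_apply (x : ι → EuclideanSpace ℂ β) (κ : ι → β) :
    tensorMap ι β x κ = ∏ i, x i (κ i) := by
  simp [tensorMap]

/-- The Euclidean norm is a cross norm. This gives the multilinear bound with constant `1` whatever
the number of coordinates. -/
theorem norm_tensorMap (x : ι → EuclideanSpace ℂ β) : ‖tensorMap ι β x‖ = ∏ i, ‖x i‖ := by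
  rw [← sq_eq_sq₀ (norm_nonneg _) (Finset.prod_nonneg fun _ _ => norm_nonneg _),
    EuclideanSpace.norm_sq_eq, ← Finset.prod_pow]
  simp only [tensorMap_apply, EuclideanSpace.norm_sq_eq, Finset.prod_univ_sum, norm_prod,
    Fintype.piFinset_univ, Finset.prod_pow]

end TensorMap

/-! ### Evaluating moment and cumulant tensors. -/

section Moments

theorem map_integral_comp_of_bound {Ω V F K : Type*} [MeasurableSpace Ω] {P : Measure Ω}
    [NormedAddCommGroup V] [NormedAddCommGroup F] [NormedSpace ℝ F] [CompleteSpace F]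
    [NormedAddCommGroup K] [NormedSpace ℝ K] [CompleteSpace K] {g : V → F} (hg : Continuous g)
    {Y : Ω → V} (hY : AEStronglyMeasurable Y P) {c : Ω → ℝ≥0∞} (hc : ∫⁻ ω, c ω ∂P < ∞)
    (hgc : ∀ ω, ‖g (Y ω)‖ₑ ≤ c ω) (L : F →ₗ[ℝ] K) (C : ℝ) (hL : ∀ x, ‖L x‖ ≤ C * ‖x‖) :
    L (∫ ω, g (Y ω) ∂P) = ∫ ω, L (g (Y ω)) ∂P :=
  ((L.mkContinuous C hL).integral_comp_comm
    ⟨hg.comp_aestronglyMeasurable hY, (lintegral_mono hgc).trans_lt hc⟩).symm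

variable {𝕜 : Type*} [RCLike 𝕜] {H : Type*} [NormedAddCommGroup H] [InnerProductSpace 𝕜 H]

theorem simpleTensor_apply {ι : Type*} [Fintype ι] (x : ι → H) (f : ι → StrongDual 𝕜 H) :
    simpleTensor 𝕜 x f = ∏ i, f i (x i) := by
  simp [simpleTensor]

theorem norm_simpleTensor_le {ι : Type*} [Fintype ι] (x : ι → H) :
    ‖simpleTensor 𝕜 x‖ ≤ ∏ i, ‖x i‖ := by
  refine ContinuousMultilinearMap.opNorm_le_bound (Finset.prod_nonneg fun _ _ => norm_nonneg _)
    fun f => ?_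
  rw [simpleTensor_apply, norm_prod, ← Finset.prod_mul_distrib]
  refine Finset.prod_le_prod (fun _ _ => norm_nonneg _) fun i _ => ?_
  rw [mul_comm]
  exact (f i).le_opNorm _

theorem continuous_simpleTensor {ι : Type*} [Fintype ι] :
    Continuous fun x : ι → H => simpleTensor 𝕜 x := by
  have h1 : Continuous fun x : ι → H => fun i => ContinuousLinearMap.apply 𝕜 𝕜 (x i) :=
    continuous_pi fun i => (ContinuousLinearMap.apply 𝕜 𝕜).continuous.comp (continuous_apply i)
  have h2 := (ContinuousMultilinearMap.compContinuousLinearMapContinuousMultilinear 𝕜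
    (fun _ : ι => StrongDual 𝕜 H) (fun _ : ι => 𝕜) 𝕜).cont.comp h1
  exact h2.clm_apply continuous_const

variable {Ω : Type*} [MeasurableSpace Ω] {P : Measure Ω} [IsProbabilityMeasure P]

theorem momentTensor_apply [SecondCountableTopology H] {ι : Type*} [Fintype ι] [Nonempty ι]
    {p : ℝ≥0∞} (hp : (Fintype.card ι : ℝ≥0∞) ≤ p) {Y : ι → Ω → H} (hY : ∀ i, MemLp (Y i) p P)
    (f : ι → StrongDual 𝕜 H) :
    momentTensor 𝕜 P Y f = ∫ ω, ∏ i, f i (Y i ω) ∂P := by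
  have hY' : ∀ i, MemLp (Y i) (Fintype.card ι) P := fun i => (hY i).mono_exponent hp
  let L : Tensor 𝕜 H ι →ₗ[ℝ] 𝕜 :=
    { toFun := fun A => A f
      map_add' := fun _ _ => rfl
      map_smul' := fun _ _ => rfl }
  have h := map_integral_comp_of_bound (F := Tensor 𝕜 H ι) (P := P) continuous_simpleTensor
    (aestronglyMeasurable_pi fun i => (hY i).1)
    ((lintegral_prod_enorm_le rfl Fintype.card_ne_zero fun i => (hY' i).1).trans_lt
        (ENNReal.prod_lt_top fun i _ => (hY' i).2)) (fun ω => ?_) L (∏ i, ‖f i‖) fun A => ?_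
  · rw [momentTensor]
    refine h.trans (integral_congr_ae (Filter.Eventually.of_forall fun ω => ?_))
    exact simpleTensor_apply _ _
  · have := norm_simpleTensor_le (𝕜 := 𝕜) fun i => Y i ω
    simp only [enorm_eq_nnnorm]
    exact_mod_cast (show ‖simpleTensor 𝕜 fun i => Y i ω‖₊ ≤ ∏ i, ‖Y i ω‖₊ by
      rw [← NNReal.coe_le_coe]; push_cast; exact this)
  · rw [mul_comm]
    exact A.le_opNorm f

theorem cumulant_apply [SecondCountableTopology H] {ι : Type*} [Fintype ι] [DecidableEq ι]
    {p : ℝ≥0∞} (hp : (Fintype.card ι : ℝ≥0∞) ≤ p) {Y : ι → Ω → H} (hY : ∀ i, MemLp (Y i) p P)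
    (f : ι → StrongDual 𝕜 H) :
    cumulant 𝕜 P Y f = ∑ v : Finpartition (Finset.univ : Finset ι),
      ((-1 : 𝕜) ^ (v.parts.card - 1) * ((v.parts.card - 1)! : 𝕜)) *
        ∏ B ∈ v.parts, ∫ ω, ∏ i ∈ B, f i (Y i ω) ∂P := by
  rw [cumulant, sum_apply]
  refine Finset.sum_congr rfl fun v _ => ?_
  rw [smul_apply, smul_eq_mul]
  congr 1
  refine Finset.prod_congr rfl fun B hB => ?_
  have : Nonempty B := (v.nonempty_of_mem_parts hB).to_subtype
  rw [momentTensor_apply (le_trans ?_ hp) fun i : B => hY i]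
  · refine integral_congr_ae (Filter.Eventually.of_forall fun ω => ?_)
    exact Finset.prod_coe_sort B fun i => f i (Y i ω)
  · rw [Fintype.card_coe]
    exact_mod_cast Finset.card_le_univ B

end Moments

/-! ### Passage to complex coordinates and the Hilbert–Schmidt bound. -/

section ToComplex

variable (𝕜 : Type*) [RCLike 𝕜]

/-- The embedding of the scalar field into `ℂ`. -/
def toComplex : 𝕜 →+* ℂ where
  toFun := RCLike.map 𝕜 ℂ
  map_zero' := map_zero _
  map_add' := map_add _
  map_one' := by simp
  map_mul' z w := by
    apply Complex.ext <;> simp [RCLike.map_apply]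

variable {𝕜}

/-- For `𝕜 = ℝ` the roots of unity have to be found in `ℂ`; an isometric embedding costs nothing in
the estimates. -/
theorem norm_toComplex (z : 𝕜) : ‖toComplex 𝕜 z‖ = ‖z‖ := by
  rw [← sq_eq_sq₀ (norm_nonneg _) (norm_nonneg _), ← RCLike.normSq_eq_def' z, RCLike.normSq_apply,
    ← Complex.normSq_eq_norm_sq, Complex.normSq_apply]
  simp [toComplex]

theorem toComplex_integral {Ω : Type*} [MeasurableSpace Ω] {P : Measure Ω} (f : Ω → 𝕜) :
    toComplex 𝕜 (∫ ω, f ω ∂P) = ∫ ω, toComplex 𝕜 (f ω) ∂P := by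
  let e : 𝕜 →ₗᵢ[ℝ] ℂ := ⟨(RCLike.map 𝕜 ℂ).toLinearMap, norm_toComplex⟩
  exact (e.integral_comp_comm f).symm

variable {H : Type*} [NormedAddCommGroup H] [InnerProductSpace 𝕜 H] {α : Type*}

/-- Finitely many coordinates of a vector in an orthonormal basis, as complex numbers. -/
def coords (b : HilbertBasis α 𝕜 H) (s : Finset α) : H →+ EuclideanSpace ℂ s where
  toFun h := WithLp.toLp 2 fun a => toComplex 𝕜 (inner 𝕜 (b a) h)
  map_zero' := by ext; simp
  map_add' x y := by ext; simp [inner_add_right]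

theorem coords_apply (b : HilbertBasis α 𝕜 H) (s : Finset α) (h : H) (a : s) :
    coords b s h a = toComplex 𝕜 (inner 𝕜 (b a) h) := rfl

theorem norm_coords_le (b : HilbertBasis α 𝕜 H) (s : Finset α) (h : H) : ‖coords b s h‖ ≤ ‖h‖ := by
  rw [← sq_le_sq₀ (norm_nonneg _) (norm_nonneg _), EuclideanSpace.norm_sq_eq]
  simp only [coords_apply, norm_toComplex]
  rw [Finset.sum_coe_sort s fun a => ‖inner 𝕜 (b a) h‖ ^ 2]
  exact b.orthonormal.sum_inner_products_le h

theorem continuous_coords (b : HilbertBasis α 𝕜 H) (s : Finset α) : Continuous (coords b s) :=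
  AddMonoidHomClass.continuous_of_bound _ 1 fun h => by simpa using norm_coords_le b s h

variable {T : Type*} [MeasurableSpace T] {ρ : Measure T} [IsProbabilityMeasure ρ]

/-- The signs in `diff` are integers, so additivity of `coords` is enough although the scalars
change from `𝕜` to `ℂ`. -/
theorem diffNorm_coords_le (b : HilbertBasis α 𝕜 H) (s : Finset α) (p : ℝ≥0∞) (A : Finset ℤ)
    (y : (ℤ → T) → H) : diffNorm ρ p A (coords b s ∘ y) ≤ diffNorm ρ p A y := by
  refine eLpNorm_mono fun z => ?_
  have : diff A (coords b s ∘ y) z = coords b s (diff A y z) := by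
    simp [diff, map_sum, map_zsmul]
  rw [this]
  exact norm_coords_le b s _

theorem memLp_coords (b : HilbertBasis α 𝕜 H) (s : Finset α) {p : ℝ≥0∞} {y : (ℤ → T) → H}
    (hy : MemLp y p (siteMeasure ρ)) : MemLp (coords b s ∘ y) p (siteMeasure ρ) :=
  hy.mono ((continuous_coords b s).comp_aestronglyMeasurable hy.1)
    (Filter.Eventually.of_forall fun _ => norm_coords_le b s _)

/-- Finitely many multi-indices use only finitely many basis vectors. -/
theorem hsNorm_le_of_finset {ι : Type*} [Fintype ι] [DecidableEq ι] (b : HilbertBasis α 𝕜 H)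
    (A : Tensor 𝕜 H ι) {c : ℝ≥0∞}
    (h : ∀ s : Finset α, (∑ κ : ι → s, ‖A fun i => innerSL 𝕜 (b (κ i))‖ₑ ^ 2) ^ (1 / 2 : ℝ) ≤ c) :
    hsNorm b A ≤ c := by
  classical
  have h2 : ∀ x : ℝ≥0∞, x ^ (1 / 2 : ℝ) ≤ c ↔ x ≤ c ^ (2 : ℝ) := fun x => by
    rw [one_div, ENNReal.rpow_inv_le_iff two_pos]
  simp only [hsNorm, h2] at h ⊢
  rw [ENNReal.tsum_eq_iSup_sum]
  refine iSup_le fun K => ?_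
  set s : Finset α := K.biUnion fun κ => Finset.univ.image κ with hs
  refine le_trans ?_ (h s)
  let e : (ι → s) ↪ (ι → α) :=
    ⟨fun κ i => κ i, fun κ κ' hκ => funext fun i => Subtype.ext (congrFun hκ i)⟩
  have : K ⊆ Finset.univ.map e := by
    intro κ hκ
    refine Finset.mem_map.2 ⟨fun i => ⟨κ i, ?_⟩, Finset.mem_univ _, rfl⟩
    exact Finset.mem_biUnion.2 ⟨κ, hκ, Finset.mem_image_of_mem _ (Finset.mem_univ i)⟩
  refine (Finset.sum_le_sum_of_subset this).trans (le_of_eq ?_)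
  rw [Finset.sum_map]
  rfl

variable {Ω : Type*} [MeasurableSpace Ω] {P : Measure Ω} [IsProbabilityMeasure P]

/-- The Hilbert–Schmidt norm of a joint cumulant of functionals of an i.i.d. sequence is bounded by
a sum over trees of products of norms of iterated differences. -/
theorem hsNorm_cumulant_le [SecondCountableTopology H] {ι : Type*} [Fintype ι] [LinearOrder ι]
    (b : HilbertBasis α 𝕜 H) {k : ℕ} (hk : Fintype.card ι = k + 1) (i₀ : ι)
    {ξ : Ω → ℤ → T} (hξ : MeasurePreserving ξ P (siteMeasure ρ)) {y : ι → (ℤ → T) → H}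
    (hy : ∀ i, MemLp (y i) (k + 1 : ℕ) (siteMeasure ρ)) {Y : ι → Ω → H}
    (hY : ∀ i, Y i =ᵐ[P] y i ∘ ξ) :
    hsNorm b (cumulant 𝕜 P Y) ≤ (2 ^ (k + 1)) ^ k * ((k + 1 : ℕ) ^ (k + 1) *
        growthSum k {i₀} (fun i A => diffNorm ρ (k + 1 : ℕ) A (y i))) := by
  refine hsNorm_le_of_finset b _ fun s => ?_
  obtain ⟨ω, hω⟩ : ∃ ω : ℂ, IsPrimitiveRoot ω (k + 1) :=
    ⟨_, Complex.isPrimitiveRoot_exp (k + 1) (Nat.succ_ne_zero k)⟩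
  have hyc : ∀ i, MemLp (coords b s ∘ y i) (k + 1 : ℕ) (siteMeasure ρ) := fun i =>
    memLp_coords b s (hy i)
  set I := ∫ x, tensorMap ι s (fun i => copies (M := k + 1) ω (coords b s ∘ y i) x)
    ∂siteMeasure (copyMeasure (k + 1) ρ) with hI
  have hbound : ‖I‖ₑ ≤ _ := enorm_integral_copies_le (tensorMap ι s)
    (fun x => (norm_tensorMap x).le) hk hω i₀ hyc
  have hYmem : ∀ i, MemLp (Y i) (k + 1 : ℕ) P := fun i =>
    (memLp_congr_ae (hY i)).2 ((hy i).comp_measurePreserving hξ)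
  -- A single vector integral carries all coordinates of the cumulant, so one norm bound controls
  -- their whole square sum.
  have hcoord : ∀ κ : ι → s, I κ =
      (k + 1 : ℕ) * toComplex 𝕜 (cumulant 𝕜 P Y fun i => innerSL 𝕜 (b (κ i))) := by
    intro κ
    have hintg := integrable_multilinear (tensorMap ι s) hk (Nat.succ_ne_zero k)
      (U := fun i => copies (M := k + 1) ω (coords b s ∘ y i)) fun i => memLp_copies (hyc i)
    have h1 : I κ = ∫ x, ∏ i, copies (M := k + 1) ω (fun w => coords b s (y i w) (κ i)) x
        ∂siteMeasure (copyMeasure (k + 1) ρ) := by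
      have := (EuclideanSpace.proj (𝕜 := ℂ) κ : EuclideanSpace ℂ (ι → s) →L[ℂ] ℂ).integral_comp_comm
        hintg
      simp only [PiLp.proj_apply, tensorMap_apply] at this
      rw [hI, ← this]
      refine integral_congr_ae (Filter.Eventually.of_forall fun x => ?_)
      refine Finset.prod_congr rfl fun i _ => ?_
      simp [copies]
    have hf : ∀ i, MemLp (fun w => coords b s (y i w) (κ i)) (k + 1 : ℕ) (siteMeasure ρ) := fun i =>
      (hyc i).mono ((EuclideanSpace.proj (𝕜 := ℂ) (κ i)).continuous.comp_aestronglyMeasurable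
        (hyc i).1) (Filter.Eventually.of_forall fun w => PiLp.norm_apply_le _ _)
    rw [h1, integral_prod_copies hk hω hf, cumulant_apply (by rw [hk]) hYmem, map_sum]
    congr 1
    refine Finset.sum_congr rfl fun v _ => ?_
    rw [map_mul, map_mul, map_pow, map_neg, map_one, map_natCast, map_prod]
    congr 1
    refine Finset.prod_congr rfl fun B _ => ?_
    have hmeas : AEStronglyMeasurable (fun w => ∏ i ∈ B, coords b s (y i w) (κ i))
        (siteMeasure ρ) := Finset.aestronglyMeasurable_fun_prod _ fun i _ => (hf i).1
    rw [toComplex_integral, ← integral_comp_measurePreserving hξ hmeas]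
    refine integral_congr_ae ?_
    filter_upwards [(Filter.eventually_all).2 hY] with w hw
    rw [map_prod]
    refine Finset.prod_congr rfl fun i _ => ?_
    rw [hw i, coords_apply, innerSL_apply_apply, Function.comp_apply]
  have hle : (∑ κ : ι → s, ‖cumulant 𝕜 P Y fun i => innerSL 𝕜 (b (κ i))‖ₑ ^ 2) ^ (1 / 2 : ℝ) ≤
      ‖I‖ₑ := by
    rw [one_div, ENNReal.rpow_inv_le_iff two_pos]
    have hn : ‖I‖ₑ ^ (2 : ℝ) = ∑ κ, ‖I κ‖ₑ ^ 2 := by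
      have := EuclideanSpace.norm_sq_eq I
      rw [← ofReal_norm]
      simp only [← ofReal_norm]
      rw [show ((2 : ℝ)) = ((2 : ℕ) : ℝ) by norm_num, ENNReal.rpow_natCast,
        ← ENNReal.ofReal_pow (norm_nonneg _), this,
        ENNReal.ofReal_sum_of_nonneg fun _ _ => by positivity]
      exact Finset.sum_congr rfl fun κ _ => ENNReal.ofReal_pow (norm_nonneg _) 2
    rw [hn]
    refine Finset.sum_le_sum fun κ _ => ?_
    gcongr
    rw [enorm_le_iff_norm_le, hcoord κ, norm_mul, norm_toComplex]
    refine le_mul_of_one_le_left (norm_nonneg _) ?_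
    rw [Complex.norm_natCast]
    exact_mod_cast Nat.le_add_left 1 k
  refine hle.trans (hbound.trans ?_)
  gcongr
  exact growthSum_mono fun i A => diffNorm_coords_le b s _ A (y i)

end ToComplex

/-! ### Integrating out sites. -/

section IntegrateOut

variable {S : Type*} [MeasurableSpace S] {H : Type*} [NormedAddCommGroup H]

theorem sel_empty_zipPair (x y : ℤ → S) : sel ∅ (zipPair (x, y)) = x := by
  funext s
  simp [sel, zipPair]

theorem sel_swapAt_self (I : Finset ℤ) (z : ℤ → Fin 2 → S) : sel I (swapAt I z) = sel ∅ z := by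
  funext s
  by_cases hs : s ∈ I <;> simp [sel, swapAt, hs]

theorem sel_empty_swapAt (I : Finset ℤ) (z : ℤ → Fin 2 → S) : sel ∅ (swapAt I z) = sel I z := by
  funext s
  by_cases hs : s ∈ I <;> simp [sel, swapAt, hs]

variable [NormedSpace ℝ H]

/-- Integrate out the sites in `I`. -/
def integrateOut (ρ : Measure S) (I : Finset ℤ) (G : (ℤ → S) → H) (x : ℤ → S) : H :=
  ∫ y, G (sel I (zipPair (x, y))) ∂siteMeasure ρ

theorem integrateOut_congr (ρ : Measure S) (I : Finset ℤ) (G : (ℤ → S) → H) {x x' : ℤ → S}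
    (h : ∀ s ∉ I, x s = x' s) : integrateOut ρ I G x = integrateOut ρ I G x' := by
  refine integral_congr_ae (Filter.Eventually.of_forall fun y => ?_)
  dsimp only
  congr 1
  funext s
  by_cases hs : s ∈ I
  · simp [sel, zipPair, hs]
  · simp [sel, zipPair, hs, h s hs]

variable {ρ : Measure S} [IsProbabilityMeasure ρ] {G : (ℤ → S) → H} {p : ℝ≥0∞}

theorem integrateOut_empty [CompleteSpace H] : integrateOut ρ ∅ G = G := by
  funext x
  simp [integrateOut, sel_empty_zipPair]

theorem measurePreserving_sel_zipPair (ρ : Measure S) [IsProbabilityMeasure ρ] (I : Finset ℤ) :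
    MeasurePreserving (fun w : (ℤ → S) × (ℤ → S) => sel I (zipPair w))
      ((siteMeasure ρ).prod (siteMeasure ρ)) (siteMeasure ρ) :=
  (measurePreserving_sel ρ I).comp (measurePreserving_zipPair ρ)

theorem memLp_integrateOut (hp1 : 1 ≤ p) (hp : p ≠ ∞) (hG : MemLp G p (siteMeasure ρ))
    (I : Finset ℤ) : MemLp (integrateOut ρ I G) p (siteMeasure ρ) := by
  have h := hG.comp_measurePreserving (measurePreserving_sel_zipPair ρ I)
  exact ⟨h.1.integral_prod_right', (eLpNorm_integral_prod_le hp1 hp h.1).trans_lt h.2⟩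

/-- This is the defining identity of a conditional expectation given the coupled sequence. Swapping
the pairs at `I` moves the event to the first members and the function to the mixed sequence;
integrating the second members then gives `integrateOut` on both sides, as it is idempotent. -/
theorem integral_indicator_integrateOut (hG : Integrable G (siteMeasure ρ)) (I : Finset ℤ)
    {D : Set (ℤ → S)} (hD : MeasurableSet D) :
    ∫ z, (sel I ⁻¹' D).indicator (integrateOut ρ I G ∘ sel ∅) z ∂siteMeasure (pairMeasure ρ) =
      ∫ z, (sel I ⁻¹' D).indicator (G ∘ sel ∅) z ∂siteMeasure (pairMeasure ρ) := by
  have hswap := measurePreserving_swapAt ρ I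
  have hz := measurePreserving_zipPair ρ
  have hsel := fun B => measurePreserving_sel ρ B
  have hGp : MemLp G 1 (siteMeasure ρ) := memLp_one_iff_integrable.2 hG
  have hI : MemLp (integrateOut ρ I G) 1 (siteMeasure ρ) :=
    memLp_integrateOut le_rfl ENNReal.one_ne_top hGp I
  have key : ∀ K : (ℤ → S) → H, MemLp K 1 (siteMeasure ρ) →
      ∫ z, (sel I ⁻¹' D).indicator (K ∘ sel ∅) z ∂siteMeasure (pairMeasure ρ) =
      ∫ x, D.indicator (fun x => ∫ y, K (sel I (zipPair (x, y))) ∂siteMeasure ρ) x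
        ∂siteMeasure ρ := by
    intro K hK
    have hm1 : AEStronglyMeasurable ((sel I ⁻¹' D).indicator (K ∘ sel ∅))
        (siteMeasure (pairMeasure ρ)) :=
      (hK.1.comp_measurePreserving (hsel ∅)).indicator ((hsel I).measurable hD)
    have hm2 : Integrable ((sel ∅ ⁻¹' D).indicator (K ∘ sel I)) (siteMeasure (pairMeasure ρ)) :=
      (memLp_one_iff_integrable.1 (hK.comp_measurePreserving (hsel I))).indicator
        ((hsel ∅).measurable hD)
    have hm3 : Integrable (fun w => (sel ∅ ⁻¹' D).indicator (K ∘ sel I) (zipPair w))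
        ((siteMeasure ρ).prod (siteMeasure ρ)) :=
      memLp_one_iff_integrable.1 ((memLp_one_iff_integrable.2 hm2).comp_measurePreserving hz)
    have e1 : ∀ z, (sel I ⁻¹' D).indicator (K ∘ sel ∅) (swapAt I z) =
        (sel ∅ ⁻¹' D).indicator (K ∘ sel I) z := by
      intro z
      have hiff : swapAt I z ∈ sel I ⁻¹' D ↔ z ∈ sel ∅ ⁻¹' D := by
        simp only [Set.mem_preimage, sel_swapAt_self]
      by_cases h : z ∈ sel ∅ ⁻¹' D
      · rw [Set.indicator_of_mem h, Set.indicator_of_mem (hiff.2 h), Function.comp_apply,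
          Function.comp_apply, sel_empty_swapAt]
      · rw [Set.indicator_of_notMem h, Set.indicator_of_notMem (mt hiff.1 h)]
    rw [← integral_comp_measurePreserving hswap hm1]
    simp only [e1]
    rw [← integral_comp_measurePreserving hz hm2.1, integral_prod _ hm3]
    refine integral_congr_ae (Filter.Eventually.of_forall fun x => ?_)
    by_cases hx : x ∈ D
    · simp [Set.indicator, sel_empty_zipPair, hx]
    · simp [Set.indicator, sel_empty_zipPair, hx]
  rw [key _ hI, key _ hGp]
  refine integral_congr_ae (Filter.Eventually.of_forall fun x => ?_)
  congr 1
  funext x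
  have : ∀ y, integrateOut ρ I G (sel I (zipPair (x, y))) = integrateOut ρ I G x := fun y =>
    integrateOut_congr ρ I G fun s hs => by simp [sel, zipPair, hs]
  simp only [this]
  -- Without completeness both Bochner integrals are `0` by convention.
  by_cases hc : CompleteSpace H
  · rw [integral_const, probReal_univ, one_smul]
    rfl
  · simp [integral, hc, integrateOut]

end IntegrateOut

/-! ### Iterated differences and the dependence coefficients. -/

section Dependence

variable {Ω S H : Type*} [mΩ : MeasurableSpace Ω] [MeasurableSpace S] {P : Measure Ω}
  [IsProbabilityMeasure P] {ε ε' : ℤ → Ω → S}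

theorem measurePreserving_innovations (hε : IsIID P ε) :
    MeasurePreserving (fun ω t => ε t ω) P (siteMeasure (P.map (ε 0))) where
  measurable := measurable_pi_lambda _ hε.measurable
  map_eq := by
    rw [hε.indep.map_fun_eq_infinitePi_map hε.measurable]
    simp only [(hε.identDistrib _).map_eq]

theorem measurePreserving_innovationPairs (hε : IsIID P ε) (hε' : IsIndepCopy P ε ε') :
    MeasurePreserving (fun ω => zipPair (fun t => ε t ω, fun t => ε' t ω)) P
      (siteMeasure (pairMeasure (P.map (ε 0)))) := by
  have hξ := measurePreserving_innovations hε
  have hm : Measurable fun ω t => ε' t ω := measurable_pi_lambda _ hε'.measurable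
  have : IsProbabilityMeasure (P.map (ε 0)) :=
    Measure.isProbabilityMeasure_map (hε.measurable 0).aemeasurable
  refine (measurePreserving_zipPair _).comp ⟨hξ.measurable.prodMk hm, ?_⟩
  rw [(indepFun_iff_map_prod_eq_prod_map_map hξ.measurable.aemeasurable hm.aemeasurable).1
    hε'.indep, hε'.identDistrib.map_eq, hξ.map_eq]

theorem coupled_eq_sel (I : Finset ℤ) (t : ℤ) (ω : Ω) :
    coupled ε ε' I t ω = sel I (zipPair (fun t => ε t ω, fun t => ε' t ω)) t := by
  by_cases ht : t ∈ I
  · simp [coupled, sel, zipPair, ht]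
  · simp [coupled, sel, zipPair, ht]

theorem measurable_coupled (hε : IsIID P ε) (hε' : IsIndepCopy P ε ε') (I : Set ℤ) (t : ℤ) :
    Measurable (coupled ε ε' I t) := by
  unfold coupled
  split_ifs
  exacts [hε'.measurable t, hε.measurable t]

theorem coupledPast_le (hε : IsIID P ε) (hε' : IsIndepCopy P ε ε') (t : ℤ) (I : Set ℤ) :
    coupledPast ε ε' t I ≤ mΩ :=
  iSup₂_le fun s _ => (measurable_coupled hε hε' I s).comap_le

theorem coupledPast_eq_comap (I : Set ℤ) :
    coupledPast ε ε' 0 I =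
      MeasurableSpace.comap (fun ω (k : ℕ) => coupled ε ε' I (0 - k) ω) inferInstance := by
  refine le_antisymm (iSup₂_le fun s hs => ?_) ?_
  · have h1 : coupled ε ε' I s = (fun z : ℕ → S => z (-s).toNat) ∘
        fun ω (k : ℕ) => coupled ε ε' I (0 - k) ω := by
      funext ω
      have : (0 : ℤ) - ((-s).toNat : ℤ) = s := by omega
      simp only [Function.comp_apply, this]
    rw [h1, ← MeasurableSpace.comap_comp]
    exact MeasurableSpace.comap_mono (measurable_pi_apply _).comap_le
  · rw [← measurable_iff_comap_le]
    refine @measurable_pi_lambda _ _ _ (coupledPast ε ε' 0 I) _ _ fun k => ?_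
    rw [measurable_iff_comap_le]
    exact le_iSup₂_of_le (0 - (k : ℤ)) (by omega) le_rfl

/-- The functional `g` of the past of the site `t`. -/
def causal (g : (ℕ → S) → H) (t : ℤ) (x : ℤ → S) : H := g fun k => x (t - k)

theorem measurable_causal [MeasurableSpace H] {g : (ℕ → S) → H} (hg : Measurable g) (t : ℤ) :
    Measurable (causal g t) :=
  hg.comp (measurable_pi_lambda _ fun _ => measurable_pi_apply _)

variable [NormedAddCommGroup H] [NormedSpace ℝ H] [CompleteSpace H] [MeasurableSpace H]
  [BorelSpace H] [SecondCountableTopology H]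

/-- At the sites of `I` the coupled sequence carries only `ε'`, which tells nothing about `X₀`; at
the other sites it equals `ε`. -/
theorem condExp_coupledPast (hε : IsIID P ε) (hε' : IsIndepCopy P ε ε') {g : (ℕ → S) → H}
    (hg : Measurable g) {X₀ : Ω → H} (hX : X₀ =ᵐ[P] fun ω => causal g 0 fun t => ε t ω)
    (hintg : Integrable X₀ P) (I : Finset ℤ) :
    P[X₀ | coupledPast ε ε' 0 I] =ᵐ[P]
      fun ω => integrateOut (P.map (ε 0)) I (causal g 0) fun t => ε t ω := by
  have : IsProbabilityMeasure (P.map (ε 0)) :=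
    Measure.isProbabilityMeasure_map (hε.measurable 0).aemeasurable
  set ρ := P.map (ε 0) with hρ
  have hξ : MeasurePreserving (fun ω t => ε t ω) P (siteMeasure ρ) :=
    measurePreserving_innovations hε
  set Z : Ω → ℤ → Fin 2 → S := fun ω => zipPair (fun t => ε t ω, fun t => ε' t ω) with hZdef
  have hZ : MeasurePreserving Z P (siteMeasure (pairMeasure ρ)) :=
    measurePreserving_innovationPairs hε hε'
  have hGm : AEStronglyMeasurable (causal g 0) (siteMeasure ρ) :=
    (measurable_causal hg 0).aestronglyMeasurable
  have hG : Integrable (causal g 0) (siteMeasure ρ) := by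
    rw [← hξ.integrable_comp hGm]
    exact hintg.congr hX
  have hIo : Integrable (integrateOut ρ I (causal g 0)) (siteMeasure ρ) :=
    memLp_one_iff_integrable.1 (memLp_integrateOut le_rfl ENNReal.one_ne_top
      (memLp_one_iff_integrable.2 hG) I)
  have hIoξ : Integrable (fun ω => integrateOut ρ I (causal g 0) fun t => ε t ω) P :=
    (hξ.integrable_comp hIo.1).2 hIo
  have hm := coupledPast_le hε hε' 0 (I : Set ℤ)
  refine (ae_eq_condExp_of_forall_setIntegral_eq hm hintg (fun _ _ _ => hIoξ.integrableOn)
    (fun s hs _ => ?_) ?_).symm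
  · rw [coupledPast_eq_comap] at hs
    obtain ⟨A, hA, rfl⟩ := hs
    set D : Set (ℤ → S) := (fun x (k : ℕ) => x (0 - k)) ⁻¹' A with hD
    have hDm : MeasurableSet D := (measurable_pi_lambda _ fun _ => measurable_pi_apply _) hA
    have hpre : (fun ω (k : ℕ) => coupled ε ε' I (0 - k) ω) ⁻¹' A = Z ⁻¹' (sel I ⁻¹' D) := by
      ext ω
      simp only [Set.mem_preimage, hD, coupled_eq_sel, hZdef]
    have hmeas : MeasurableSet (Z ⁻¹' (sel I ⁻¹' D)) :=
      hZ.measurable ((measurePreserving_sel ρ I).measurable hDm)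
    rw [hpre, setIntegral_congr_ae hmeas (hX.mono fun ω h _ => h),
      ← integral_indicator hmeas, ← integral_indicator hmeas]
    have conv : ∀ K : (ℤ → S) → H, AEStronglyMeasurable K (siteMeasure ρ) →
        ∫ ω, (Z ⁻¹' (sel I ⁻¹' D)).indicator (fun ω => K fun t => ε t ω) ω ∂P =
        ∫ z, (sel I ⁻¹' D).indicator (K ∘ sel ∅) z ∂siteMeasure (pairMeasure ρ) := by
      intro K hK
      rw [← integral_comp_measurePreserving hZ
        ((hK.comp_measurePreserving (measurePreserving_sel ρ ∅)).indicator
          ((measurePreserving_sel ρ I).measurable hDm))]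
      refine integral_congr_ae (Filter.Eventually.of_forall fun ω => ?_)
      change _ = (sel I ⁻¹' D).indicator (K ∘ sel ∅) (Z ω)
      by_cases hω : Z ω ∈ sel I ⁻¹' D
      · rw [Set.indicator_of_mem hω, Set.indicator_of_mem (show ω ∈ Z ⁻¹' (sel I ⁻¹' D) from hω),
          Function.comp_apply, hZdef, sel_empty_zipPair]
      · rw [Set.indicator_of_notMem hω,
          Set.indicator_of_notMem (show ω ∉ Z ⁻¹' (sel I ⁻¹' D) from hω)]
    rw [conv _ hIo.1, conv _ hGm]
    exact integral_indicator_integrateOut hG I hDm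
  -- Measurability: once `I` is integrated out, only sites outside `I` are read, and there the
  -- coupled sequence may replace `ε`.
  · set h : (ℕ → S) → H := fun z => ∫ y : ℤ → S,
      g (fun k => if (0 - (k : ℤ)) ∈ I then y (0 - k) else z k) ∂siteMeasure ρ with hh
    have hhm : StronglyMeasurable h := by
      have : Measurable fun w : (ℕ → S) × (ℤ → S) =>
          g (fun k => if (0 - (k : ℤ)) ∈ I then w.2 (0 - k) else w.1 k) := by
        refine hg.comp (measurable_pi_lambda _ fun k => ?_)
        split_ifs
        · exact (measurable_pi_apply _).comp measurable_snd
        · exact (measurable_pi_apply _).comp measurable_fst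
      exact this.stronglyMeasurable.integral_prod_right'
    have heq : (fun ω => integrateOut ρ I (causal g 0) fun t => ε t ω) =
        h ∘ fun ω (k : ℕ) => coupled ε ε' I (0 - k) ω := by
      funext ω
      simp only [integrateOut, hh, Function.comp_apply, causal]
      refine integral_congr_ae (Filter.Eventually.of_forall fun y => ?_)
      dsimp only
      congr 1
      funext k
      rw [coupled_eq_sel]
      by_cases hk : (0 - (k : ℤ)) ∈ I <;> simp only [sel, zipPair, hk, if_true, if_false] <;> rfl
    rw [heq]
    refine StronglyMeasurable.aestronglyMeasurable ?_
    refine hhm.comp_measurable ?_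
    rw [measurable_iff_comap_le, coupledPast_eq_comap]

variable {p : ℝ≥0∞}

theorem diffNorm_le_two_pow {T : Type*} [MeasurableSpace T] {ρ : Measure T}
    [IsProbabilityMeasure ρ] (hp : 1 ≤ p) {U : (ℤ → T) → H}
    (hU : AEStronglyMeasurable U (siteMeasure ρ)) (A : Finset ℤ) :
    diffNorm ρ p A U ≤ 2 ^ A.card * eLpNorm U p (siteMeasure ρ) := by
  have hd : diff A U = ∑ B ∈ A.powerset, ((-1 : ℝ) ^ B.card) • (U ∘ sel B) := by
    funext z
    simp [diff, ← Int.cast_smul_eq_zsmul ℝ]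
  rw [diffNorm, hd]
  refine (eLpNorm_sum_le (fun B _ =>
    (hU.comp_measurePreserving (measurePreserving_sel ρ B)).const_smul _) hp).trans ?_
  refine le_trans (Finset.sum_le_sum (g := fun _ => eLpNorm U p (siteMeasure ρ)) fun B _ => ?_)
    (by simp)
  rw [eLpNorm_const_smul, eLpNorm_comp_measurePreserving hU (measurePreserving_sel ρ B)]
  simp

theorem diff_finset_sum_smul {T β : Type*} (A : Finset ℤ) (s : Finset β) (c : β → ℝ)
    (U : β → (ℤ → T) → H) (z : ℤ → Fin 2 → T) :
    diff A (fun x => ∑ l ∈ s, c l • U l x) z = ∑ l ∈ s, c l • diff A (U l) z := by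
  simp only [diff, Finset.smul_sum]
  rw [Finset.sum_comm]
  exact Finset.sum_congr rfl fun l _ => Finset.sum_congr rfl fun B _ => smul_comm _ _ _

/-- Iterated differences are controlled by the dependence coefficients. -/
theorem diffNorm_le_depCoeff (hε : IsIID P ε) (hε' : IsIndepCopy P ε ε') {g : (ℕ → S) → H}
    (hg : Measurable g) {X : ℤ → Ω → H} (hX : X 0 =ᵐ[P] fun ω => causal g 0 fun t => ε t ω)
    (hp1 : 1 ≤ p) (hp : p ≠ ∞) (hmem : MemLp (X 0) p P) {k : ℕ} (j : Fin k → ℕ) :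
    diffNorm (P.map (ε 0)) p (Finset.univ.image fun l => -(j l : ℤ)) (causal g 0) ≤
      2 ^ k * depCoeff P ε ε' X p j := by
  have : IsProbabilityMeasure (P.map (ε 0)) :=
    Measure.isProbabilityMeasure_map (hε.measurable 0).aemeasurable
  set ρ := P.map (ε 0) with hρ
  have hξ : MeasurePreserving (fun ω t => ε t ω) P (siteMeasure ρ) :=
    measurePreserving_innovations hε
  set J : Finset (Fin k) → Finset ℤ := fun L => L.image fun l => -(j l : ℤ) with hJ
  set V : (ℤ → S) → H := fun x =>
    ∑ L ∈ Finset.powerset Finset.univ,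
      (-1 : ℝ) ^ L.card • integrateOut ρ (J L) (causal g 0) x with hV
  have hGm : AEStronglyMeasurable (causal g 0) (siteMeasure ρ) :=
    (measurable_causal hg 0).aestronglyMeasurable
  have hG : MemLp (causal g 0) p (siteMeasure ρ) := by
    refine ⟨hGm, ?_⟩
    rw [← eLpNorm_comp_measurePreserving hGm hξ]
    exact ((memLp_congr_ae hX).1 hmem).2
  have hVm : AEStronglyMeasurable V (siteMeasure ρ) :=
    Finset.aestronglyMeasurable_fun_sum _ fun L _ =>
      (memLp_integrateOut hp1 hp hG (J L)).1.const_smul ((-1 : ℝ) ^ L.card)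
  -- The summand `L = ∅` of `V` is `X₀` itself; the others are the conditional expectations, grouped
  -- by the size of `L`.
  have hdep : depCoeff P ε ε' X p j = eLpNorm V p (siteMeasure ρ) := by
    rw [← eLpNorm_comp_measurePreserving hVm hξ, depCoeff]
    refine eLpNorm_congr_ae ?_
    have hc := (Filter.eventually_all).2 fun L : Finset (Fin k) =>
      condExp_coupledPast hε hε' hg hX (hmem.integrable hp1) (J L)
    filter_upwards [hX, hc] with ω h0 h1
    have hL : ∀ L : Finset (Fin k), (P[X 0 | coupledPast ε ε' 0
        ((fun l => -(j l : ℤ)) '' (L : Set (Fin k)))]) ω =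
        integrateOut ρ (J L) (causal g 0) fun t => ε t ω := by
      intro L
      rw [← h1 L]
      simp only [hJ, Finset.coe_image]
    simp only [hL, Function.comp_apply, hV]
    rw [Finset.sum_powerset, Finset.card_univ, Fintype.card_fin, Finset.range_eq_Ico,
      Finset.sum_eq_sum_Ico_succ_bot (Nat.succ_pos k)]
    congr 1
    · rw [h0]
      simp [hJ, integrateOut_empty]
    · refine Finset.sum_congr (by ext; simp [Nat.succ_le_iff]) fun i _ => ?_
      rw [Finset.smul_sum]
      refine Finset.sum_congr rfl fun L hL => ?_
      rw [(Finset.mem_powersetCard.1 hL).2]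
  -- For `L ≠ ∅` the summand does not depend on some site of the difference and is killed; only `L =
  -- ∅` survives.
  have hdiff : diff (Finset.univ.image fun l => -(j l : ℤ)) (causal g 0) =
      diff (Finset.univ.image fun l => -(j l : ℤ)) V := by
    funext z
    rw [hV, diff_finset_sum_smul, Finset.sum_eq_single ∅]
    · simp [hJ, integrateOut_empty]
    · intro L _ hL
      obtain ⟨l, hl⟩ := Finset.nonempty_iff_ne_empty.2 hL
      rw [diff_eq_zero (s := -(j l : ℤ))
          (Finset.mem_image_of_mem (fun l => -(j l : ℤ)) (Finset.mem_univ l)),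
        Pi.zero_apply, smul_zero]
      intro x x' h
      refine integrateOut_congr ρ _ _ fun s hs => h s ?_
      rintro rfl
      exact hs (Finset.mem_image_of_mem (fun l => -(j l : ℤ)) hl)
    · simp
  rw [hdep, diffNorm, hdiff]
  refine (diffNorm_le_two_pow hp1 hVm _).trans ?_
  gcongr
  · exact one_le_two
  · exact Finset.card_image_le.trans (by simp)

/-- `X₀` does not see future innovations. This is why sums over nonnegative lags suffice. -/
theorem diffNorm_causal_of_pos {ρ : Measure S} (g : (ℕ → S) → H) {A : Finset ℤ} {s : ℤ}
    (hs : s ∈ A) (h0 : 0 < s) : diffNorm ρ p A (causal g 0) = 0 := by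
  rw [diffNorm, diff_eq_zero hs, eLpNorm_zero]
  intro x x' h
  simp only [causal]
  congr 1
  funext k
  refine h _ ?_
  intro hk
  have : (0 : ℤ) - k = s := hk
  omega

/-- Stationarity: the law of the i.i.d. pairs is shift invariant. -/
theorem diffNorm_causal_shift {ρ : Measure S} [IsProbabilityMeasure ρ] {g : (ℕ → S) → H}
    (hg : Measurable g) (t : ℤ) (A : Finset ℤ) :
    diffNorm ρ p A (causal g t) = diffNorm ρ p (A.image fun r => r - t) (causal g 0) := by
  have hmp : MeasurePreserving (fun (z : ℤ → Fin 2 → S) s => z (s + t))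
      (siteMeasure (pairMeasure ρ)) (siteMeasure (pairMeasure ρ)) :=
    measurePreserving_infinitePi_comp _ (add_left_injective t)
  rw [diffNorm, diffNorm, ← eLpNorm_comp_measurePreserving
    (aestronglyMeasurable_diff (measurable_causal hg 0).aestronglyMeasurable _) hmp]
  congr 1
  funext z
  simp only [diff, Function.comp_apply]
  have hinj : Function.Injective fun r : ℤ => r - t := sub_left_injective
  refine Finset.sum_bij (fun B _ => B.image fun r => r - t) (fun B hB => ?_) (fun B _ B' _ h => ?_)
    (fun B hB => ?_) (fun B _ => ?_)
  · exact Finset.mem_powerset.2 (Finset.image_subset_image (Finset.mem_powerset.1 hB))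
  · exact Finset.image_injective hinj h
  · refine ⟨B.image fun r => r + t, ?_, ?_⟩
    · rw [Finset.mem_powerset] at hB ⊢
      intro r hr
      obtain ⟨q, hq, rfl⟩ := Finset.mem_image.1 hr
      obtain ⟨a, ha, rfl⟩ := Finset.mem_image.1 (hB hq)
      simpa using ha
    · rw [Finset.image_image]
      simp [Function.comp_def]
  · rw [Finset.card_image_of_injective _ hinj]
    congr 1
    simp only [causal]
    congr 1
    funext k
    have h1 : (0 : ℤ) - k + t = t - k := by ring
    have h2 : ((0 : ℤ) - k ∈ B.image fun r => r - t) ↔ t - (k : ℤ) ∈ B := by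
      constructor
      · intro h
        obtain ⟨r, hr, hrk⟩ := Finset.mem_image.1 h
        have : t - (k : ℤ) = r := by linarith
        rwa [this]
      · intro h
        exact Finset.mem_image.2 ⟨_, h, by ring⟩
    simp only [sel, h1, h2]

end Dependence

/-! ### Summation over times and edge sites of a tree. -/

section Summation

theorem tsum_pi_prod {M : ℕ} {β : Fin M → Type*} (f : ∀ i, β i → ℝ≥0∞) :
    ∑' x : ∀ i, β i, ∏ i, f i (x i) = ∏ i, ∑' y, f i y := by
  induction M with
  | zero => simp [tsum_fintype]
  | succ M ih =>
    rw [← (Fin.consEquiv β).tsum_eq, Fin.prod_univ_succ, ← ih fun i => f i.succ,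
      ← ENNReal.tsum_mul_right]
    simp only [Fin.consEquiv, Equiv.coe_fn_mk, Fin.prod_univ_succ, Fin.cons_zero, Fin.cons_succ]
    rw [ENNReal.tsum_prod (f := fun a (x : ∀ i : Fin M, β i.succ) =>
      f 0 a * ∏ i, f i.succ (x i))]
    simp only [ENNReal.tsum_mul_left]

variable {ι : Type*} [Fintype ι] [DecidableEq ι]

theorem IsGrowth.ne {k : ℕ} {C : Finset ι} {e : Fin k → ι × ι} (h : IsGrowth k C e) (l : Fin k) :
    (e l).1 ≠ (e l).2 := by
  induction k generalizing C with
  | zero => exact l.elim0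
  | succ k ih =>
    obtain ⟨h1, h2, h3⟩ := h
    refine Fin.cases ?_ (fun l => ?_) l
    · intro h
      exact h2 (h ▸ h1)
    · exact ih h3 l

/-- The positions of the vertices and of the edges are determined by the differences between the
position of each edge and those of its two ends. -/
theorem IsGrowth.eq_of_sub_eq {k : ℕ} {C : Finset ι} {e : Fin k → ι × ι} (h : IsGrowth k C e)
    {t t' : ι → ℤ} {s s' : Fin k → ℤ} (hC : ∀ i ∈ C, t i = t' i)
    (h1 : ∀ l, t (e l).1 - s l = t' (e l).1 - s' l)
    (h2 : ∀ l, t (e l).2 - s l = t' (e l).2 - s' l) : t = t' ∧ s = s' := by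
  induction k generalizing C with
  | zero =>
    have hC' : C = Finset.univ := h
    exact ⟨funext fun i => hC i (hC' ▸ Finset.mem_univ i), funext fun l => l.elim0⟩
  | succ k ih =>
    obtain ⟨g1, g2, g3⟩ := h
    have hs : s 0 = s' 0 := by
      have := h1 0
      rw [hC _ g1] at this
      linarith
    have ht : t (e 0).2 = t' (e 0).2 := by
      have := h2 0
      rw [hs] at this
      linarith
    obtain ⟨r1, r2⟩ := ih g3 (s := Fin.tail s) (s' := Fin.tail s') (fun i hi => by
      rcases Finset.mem_insert.1 hi with rfl | hi
      · exact ht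
      · exact hC i hi) (fun l => h1 l.succ) (fun l => h2 l.succ)
    refine ⟨r1, funext fun l => ?_⟩
    refine Fin.cases hs (fun l => ?_) l
    exact congrFun r2 l

/-- The end of the edge `q.1` singled out by `q.2`. -/
def edgeEnd {k : ℕ} (e : Fin k → ι × ι) (q : Fin k × Bool) : ι :=
  if q.2 then (e q.1).1 else (e q.1).2

/-- There are no loops, so different incidences at a vertex come from different edges. This degree
bound is why `n - 1` lags are enough. -/
theorem card_edgeEnd_le {k : ℕ} {C : Finset ι} {e : Fin k → ι × ι} (h : IsGrowth k C e) (i : ι) :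
    Fintype.card {q // edgeEnd e q = i} ≤ k := by
  refine (Fintype.card_le_of_injective (fun q : {q // edgeEnd e q = i} => q.1.1) ?_).trans_eq
    (Fintype.card_fin k)
  rintro ⟨⟨l, c⟩, hq⟩ ⟨⟨l', c'⟩, hq'⟩ hl
  obtain rfl : l = l' := hl
  have hne := h.ne l
  cases c <;> cases c'
  · rfl
  · exact (hne (hq'.trans hq.symm)).elim
  · exact (hne (hq.trans hq'.symm)).elim
  · rfl

theorem image_edgeSites_sub {k : ℕ} (e : Fin k → ι × ι) (s : Fin k → ℤ) (t : ι → ℤ) (i : ι) :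
    (edgeSites e s i).image (fun r => r - t i) =
      Finset.univ.image fun q : {q // edgeEnd e q = i} => -(t (edgeEnd e q.1) - s q.1.1) := by
  ext r
  simp only [edgeSites, Finset.mem_image, Finset.mem_filter, Finset.mem_univ, true_and]
  constructor
  · rintro ⟨_, ⟨l, hl, rfl⟩, rfl⟩
    rcases hl with hl | hl
    · refine ⟨⟨(l, true), by simpa [edgeEnd] using hl⟩, ?_⟩
      simp [edgeEnd, hl]
    · refine ⟨⟨(l, false), by simpa [edgeEnd] using hl⟩, ?_⟩
      simp [edgeEnd, hl]
  · rintro ⟨⟨⟨l, c⟩, hq⟩, rfl⟩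
    refine ⟨s l, ⟨l, ?_, rfl⟩, by rw [hq]; ring⟩
    cases c
    · exact .inr (by simpa [edgeEnd] using hq)
    · exact .inl (by simpa [edgeEnd] using hq)

/-- Summation of translation invariant vertex weights over the positions of all edges and of all
vertices but the last. -/
theorem tsum_growth_le {m : ℕ} {e : Fin m → Fin (m + 1) × Fin (m + 1)}
    (he : IsGrowth m {Fin.last m} e) (w : Finset ℤ → ℝ≥0∞) :
    ∑' t : Fin m → ℤ, ∑' s : Fin m → ℤ, ∏ i : Fin (m + 1),
        w ((edgeSites e s i).image fun r => r - (Fin.snoc t 0 : Fin (m + 1) → ℤ) i) ≤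
      ∏ i : Fin (m + 1), ∑' x : {q // edgeEnd e q = i} → ℤ,
        w (Finset.univ.image fun q => -x q) := by
  rw [← tsum_pi_prod, ← ENNReal.tsum_prod]
  let F : (Fin m → ℤ) × (Fin m → ℤ) → ∀ i : Fin (m + 1), {q // edgeEnd e q = i} → ℤ :=
    fun ts i q => (Fin.snoc ts.1 0 : Fin (m + 1) → ℤ) (edgeEnd e q.1) - ts.2 q.1.1
  -- The last time is pinned to `0`; from there the differences recover all sites and times along
  -- the tree.
  have hF : Function.Injective F := by
    rintro ⟨t, s⟩ ⟨t', s'⟩ h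
    have h' : ∀ q : Fin m × Bool, (Fin.snoc t 0 : Fin (m + 1) → ℤ) (edgeEnd e q) - s q.1 =
        (Fin.snoc t' 0 : Fin (m + 1) → ℤ) (edgeEnd e q) - s' q.1 := fun q =>
      congrFun (congrFun h (edgeEnd e q)) ⟨q, rfl⟩
    obtain ⟨r1, r2⟩ := he.eq_of_sub_eq (t := Fin.snoc t 0) (t' := Fin.snoc t' 0) (s := s) (s' := s')
      (fun i hi => by rw [Finset.mem_singleton.1 hi]; simp) (fun l => h' (l, true))
      (fun l => h' (l, false))
    refine Prod.ext (funext fun l => ?_) r2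
    have := congrFun r1 l.castSucc
    simpa using this
  refine le_trans (le_of_eq (tsum_congr fun ts => ?_)) (ENNReal.tsum_comp_le_tsum_of_injective hF
    fun x => ∏ i, w (Finset.univ.image fun q => -x i q))
  exact Finset.prod_congr rfl fun i _ => by
    rw [image_edgeSites_sub e ts.2 (Fin.snoc ts.1 0 : Fin (m + 1) → ℤ) i]

/-- Weights of nonempty sites, summable over `d`-tuples of nonnegative integers, are summable over
tuples of at most `d` integers. -/
theorem tsum_weight_lt_top {w : Finset ℤ → ℝ≥0∞} (hpos : ∀ A, ∀ s ∈ A, 0 < s → w A = 0)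
    (h0 : w ∅ < ∞) {d : ℕ} {N : (Fin d → ℕ) → ℝ≥0∞} (hN : ∑' j, N j < ∞) {c : ℝ≥0∞} (hc : c ≠ ∞)
    (hwN : ∀ j : Fin d → ℕ, w (Finset.univ.image fun l => -(j l : ℤ)) ≤ c * N j)
    {σ : Type*} [Fintype σ] (hσ : Fintype.card σ ≤ d) :
    ∑' x : σ → ℤ, w (Finset.univ.image fun q => -x q) < ∞ := by
  rcases isEmpty_or_nonempty σ with hE | hne
  · rw [tsum_eq_single (fun q => hE.elim q) fun x hx => (hx (Subsingleton.elim _ _)).elim]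
    simpa using h0
  · obtain ⟨emb⟩ : Nonempty (σ ↪ Fin d) :=
      Function.Embedding.nonempty_of_card_le (by simpa using hσ)
    -- A short tuple is padded to length `d` by repeating entries. As `r` is surjective, the set of
    -- sites is unchanged and `x ↦ x ∘ r` is injective.
    set r : Fin d → σ := Function.invFun emb with hr
    have hrs : Function.Surjective r := Function.invFun_surjective emb.injective
    have hinj : Function.Injective fun (x : σ → ℕ) q => (x q : ℤ) := fun x y h =>
      funext fun q => Int.ofNat_injective (congrFun h q)
    rw [← hinj.tsum_eq]
    · have hle : ∀ x : σ → ℕ, w (Finset.univ.image fun q => -((x q : ℕ) : ℤ)) ≤ c * N (x ∘ r) := by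
        intro x
        refine le_trans (le_of_eq ?_) (hwN (x ∘ r))
        congr 1
        ext a
        simp only [Finset.mem_image, Finset.mem_univ, true_and, Function.comp_apply]
        exact ⟨fun ⟨q, hq⟩ => by obtain ⟨l, rfl⟩ := hrs q; exact ⟨l, hq⟩, fun ⟨l, hl⟩ => ⟨r l, hl⟩⟩
      refine (ENNReal.tsum_le_tsum hle).trans_lt ?_
      rw [ENNReal.tsum_mul_left]
      refine ENNReal.mul_lt_top hc.lt_top (lt_of_le_of_lt ?_ hN)
      exact ENNReal.tsum_comp_le_tsum_of_injective hrs.injective_comp_right N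
    -- A negative entry gives a positive site, where the weight vanishes, so the support consists of
    -- tuples of natural numbers.
    · intro x hx
      by_contra hn
      apply hx
      have : ∃ q, x q < 0 := by
        by_contra! hall
        exact hn ⟨fun q => (x q).toNat, funext fun q => Int.toNat_of_nonneg (hall q)⟩
      obtain ⟨q, hq⟩ := this
      exact hpos _ (-x q) (Finset.mem_image_of_mem _ (Finset.mem_univ q)) (by omega)

end Summation

end FunctionalCumulant

end

/-! ### The summability theorem. -/

open FunctionalCumulant

theorem theorem5p1 {𝕜 : Type*} [RCLike 𝕜]
    {H : Type*} [NormedAddCommGroup H] [InnerProductSpace 𝕜 H] [NormedSpace ℝ H]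
    [CompleteSpace H] [TopologicalSpace.SeparableSpace H] [MeasurableSpace H] [BorelSpace H]
    {Ω : Type*} [MeasurableSpace Ω] (P : Measure Ω) [IsProbabilityMeasure P]
    {S : Type*} [MeasurableSpace S]
    (ε ε' : ℤ → Ω → S)
    (hε : FunctionalCumulant.IsIID P ε) (hε' : FunctionalCumulant.IsIndepCopy P ε ε')
    (g : (ℕ → S) → H) (hg : Measurable g)
    (X : ℤ → Ω → H) (hX : ∀ t, X t =ᵐ[P] fun ω => g (fun k => ε (t - (k : ℤ)) ω))
    {α : Type*} (b : HilbertBasis α 𝕜 H)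
    (n : ℕ) (hn : 2 ≤ n)
    (hmem : ∀ t, MemLp (X t) (n : ℝ≥0∞) P)
    (hcentred : ∀ t, ∫ ω, X t ω ∂P = 0)
    (hsum : ∑' j : Fin (n - 1) → ℕ,
      FunctionalCumulant.depCoeff P ε ε' X (n : ℝ≥0∞) j < ∞) :
    ∀ m : ℕ, m + 1 ≤ n →
        ∑' t : Fin m → ℤ,
          FunctionalCumulant.hsNorm b
            (FunctionalCumulant.cumulant 𝕜 P
              (fun k : Fin (m + 1) => X ((Fin.snoc t 0 : Fin (m + 1) → ℤ) k))) < ∞ := by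
  classical
  intro m hm
  have : SecondCountableTopology H := UniformSpace.secondCountable_of_separable H
  have : IsProbabilityMeasure (P.map (ε 0)) :=
    Measure.isProbabilityMeasure_map (hε.measurable 0).aemeasurable
  set ρ := P.map (ε 0) with hρ
  have hξ : MeasurePreserving (fun ω t => ε t ω) P (siteMeasure ρ) :=
    measurePreserving_innovations hε
  have hGm : ∀ t, AEStronglyMeasurable (causal g t) (siteMeasure ρ) := fun t =>
    (measurable_causal hg t).aestronglyMeasurable
  have hG : ∀ t, MemLp (causal g t) n (siteMeasure ρ) := by
    intro t
    refine ⟨hGm t, ?_⟩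
    rw [← eLpNorm_comp_measurePreserving (hGm t) hξ]
    exact ((memLp_congr_ae (hX t)).1 (hmem t)).2
  have hmn : ((m + 1 : ℕ) : ℝ≥0∞) ≤ n := by exact_mod_cast hm
  have hn1 : (1 : ℝ≥0∞) ≤ n := by exact_mod_cast (by omega : 1 ≤ n)
  set w : Finset ℤ → ℝ≥0∞ := fun A => diffNorm ρ n A (causal g 0) with hw
  have hbound : ∀ t : Fin m → ℤ, hsNorm b (cumulant 𝕜 P
      (fun k : Fin (m + 1) => X ((Fin.snoc t 0 : Fin (m + 1) → ℤ) k))) ≤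
      ((2 ^ (m + 1)) ^ m * (m + 1 : ℕ) ^ (m + 1)) * growthSum m {Fin.last m} (fun i A =>
        w (A.image fun r => r - (Fin.snoc t 0 : Fin (m + 1) → ℤ) i)) := by
    intro t
    refine (hsNorm_cumulant_le b (Fintype.card_fin (m + 1)) (Fin.last m) hξ
      (y := fun k => causal g ((Fin.snoc t 0 : Fin (m + 1) → ℤ) k))
      (fun i => (hG _).mono_exponent hmn) fun i => hX _).trans ?_
    rw [mul_assoc]
    gcongr
    refine growthSum_mono fun i A => ?_
    rw [hw]
    dsimp only
    -- The time is moved back from the site set, and on a probability space the `L^{m+1}` norm is at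
    -- most the `L^n` norm; thus one weight `w` serves cumulants of every order up to `n`.
    rw [← diffNorm_causal_shift hg]
    exact eLpNorm_le_eLpNorm_of_exponent_le hmn (aestronglyMeasurable_diff (hGm _) A)
  refine (ENNReal.tsum_le_tsum hbound).trans_lt ?_
  rw [ENNReal.tsum_mul_left]
  refine ENNReal.mul_lt_top (ENNReal.mul_lt_top (ENNReal.pow_lt_top (ENNReal.pow_lt_top
    ENNReal.ofNat_lt_top)) (ENNReal.pow_lt_top (ENNReal.natCast_lt_top _))) ?_
  simp only [growthSum]
  rw [Summable.tsum_finsetSum fun _ _ => ENNReal.summable]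
  refine ENNReal.sum_lt_top.2 fun e he => ?_
  have hgr : IsGrowth m {Fin.last m} e := (Finset.mem_filter.1 he).2
  refine (tsum_growth_le hgr w).trans_lt (ENNReal.prod_lt_top fun i _ => ?_)
  refine tsum_weight_lt_top (fun A s hs h0 => diffNorm_causal_of_pos g hs h0) ?_ hsum
    (c := 2 ^ (n - 1)) (ENNReal.pow_ne_top ENNReal.ofNat_ne_top)
    (fun j => diffNorm_le_depCoeff hε hε' hg (hX 0) hn1 (ENNReal.natCast_ne_top n) (hmem 0) j)
    ((card_edgeEnd_le hgr i).trans (by omega))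
  rw [diffNorm_empty (hGm 0)]
  exact (hG 0).2
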